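/- Let $\mathbb H$ be the real quaternion algebra with units $\mathbf i,\mathbf j,\mathbf k$, and let $r(M)$ denote the rank of a quaternion matrix $M$ (the dimension of its right column space). For $\eta\in\{\mathbf i,\mathbf j,\mathbf k\}$ put $M^{\eta*}=-\eta M^{*}\eta$, where $M^*$ is the conjugate transpose, and call a square matrix $M$ $\eta$-Hermitian if $M=M^{\eta*}$. **Theorem.** Let $A_i\in\mathbb H^{p_i\times s_i}$, $C_i\in\mathbb H^{p_i\times s_{i+1}}$, and let $E_i\in\mathbb H^{p_i\times p_i}$ be $\eta$-Hermitian, $i=1,\dots,k$. There are $\eta$-Hermitian matrices $X_j\in\mathbb H^{s_j\times s_j}$, $j=1,\dots,k+1$, with $$A_iX_iA_i^{\eta*}+C_iX_{i+1}C_i^{\eta*}=E_i,\qquad i=1,\dots,k,$$ if and only if the following $k(k+1)$ rank equalities hold for all $i=1,\dots,k$ and all $1\le m<n\le k$: $$r\begin{pmatrix}A_i&E_i&C_i\end{pmatrix}=r\begin{pmatrix}A_i&C_i\end{pmatrix},\qquad r\begin{pmatrix}A_i&E_i\\0&C_i^{\eta*}\end{pmatrix}=r(A_i)+r(C_i),$$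 $$r\begin{pmatrix}A_m&E_m&C_m\\&C_m^{\eta*}&&A_{m+1}^{\eta*}\\&&A_{m+1}&-E_{m+1}&C_{m+1}\\&&&\ddots&\ddots&\ddots\\&&&&A_n&(-1)^{n-m}E_n&C_n\end{pmatrix} =r\begin{pmatrix}A_m&C_m\\&A_{m+1}&C_{m+1}\\&&\ddots&\ddots\\&&&A_n&C_n\end{pmatrix}+r\begin{pmatrix}C_m\\A_{m+1}&C_{m+1}\\&A_{m+2}&\ddots\\&&\ddots&C_{n-1}\\&&&A_n\end{pmatrix},$$ $$r\begin{pmatrix}A_m&E_m&C_m\\&C_m^{\eta*}&&A_{m+1}^{\eta*}\\&&A_{m+1}&-E_{m+1}&\ddots\\&&&C_{m+1}^{\eta*}&\ddots&A_n^{\eta*}\\&&&&\ddots&(-1)^{n-m}E_n\\&&&&&C_n^{\eta*}\end{pmatrix} =r\begin{pmatrix}A_m&C_m\\&A_{m+1}&C_{m+1}\\&&\ddots&\ddots\\&&&A_{n-1}&C_{n-1}\\&&&&A_n\end{pmatrix}+r\begin{pmatrix}C_m\\A_{m+1}&C_{m+1}\\&A_{m+2}&C_{m+2}\\&&\ddots&\ddots\\&&&A_n&C_n\end{pmatrix},$$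 where blank entries are zero. -/

import Mathlib

open scoped Quaternion Matrix

noncomputable section

/-- The quaternion unit `𝐢`. -/
def quatI : ℍ[ℝ] := ⟨0, 1, 0, 0⟩

/-- The quaternion unit `𝐣`. -/
def quatJ : ℍ[ℝ] := ⟨0, 0, 1, 0⟩

/-- The quaternion unit `𝐤`. -/
def quatK : ℍ[ℝ] := ⟨0, 0, 0, 1⟩

/-- The rank of a quaternion matrix: the dimension of its column space as a right `ℍ`-vector
space (right `ℍ`-modules are modules over `ℍᵐᵒᵖ`). Mathlib's `Matrix.rank` is restricted to
commutative scalars. -/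
def quatRank {m n : Type*} (M : Matrix m n ℍ[ℝ]) : ℕ :=
  Module.finrank (ℍ[ℝ])ᵐᵒᵖ (Submodule.span (ℍ[ℝ])ᵐᵒᵖ (Set.range M.col))

/-- `A^{η*} = -η A* η`, where `A*` is the conjugate transpose. -/
def etaStar {m n : Type*} (η : ℍ[ℝ]) (A : Matrix m n ℍ[ℝ]) : Matrix n m ℍ[ℝ] :=
  Aᴴ.map fun q => -η * q * η

/-- `A` is `η`-Hermitian: `A = A^{η*}`. -/
def IsEtaHermitian {n : Type*} (η : ℍ[ℝ]) (A : Matrix n n ℍ[ℝ]) : Prop :=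
  A = etaStar η A

variable {k : ℕ} {p : Fin k → ℕ} {s : Fin (k + 1) → ℕ}

/-- The `(i, j)` block of the block bidiagonal matrix which in block row `i` has `A i` in block
column `i`, `C i` in block column `i + 1`, and zeros elsewhere. -/
def bidiagBlock
    (A : ∀ i : Fin k, Matrix (Fin (p i)) (Fin (s i.castSucc)) ℍ[ℝ])
    (C : ∀ i : Fin k, Matrix (Fin (p i)) (Fin (s i.succ)) ℍ[ℝ])
    (i : Fin k) (j : Fin (k + 1)) : Matrix (Fin (p i)) (Fin (s j)) ℍ[ℝ] :=
  if h : j = i.castSucc then (A i).submatrix id (Fin.cast (congrArg s h))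
  else if h : j = i.succ then (C i).submatrix id (Fin.cast (congrArg s h))
  else 0

/-- The part of the block bidiagonal matrix with block rows `i ∈ I` and block columns `j ∈ J`.
For instance, for `I = {m, …, n}` and `J = {m, …, n + 1}` it is
```
A_m  C_m
     A_{m+1}  C_{m+1}
              ⋱        ⋱
                       A_n  C_n
```
and for `J = {m + 1, …, n}` its first block column `A_m` and its last one `C_n` are missing. -/
def bidiag
    (A : ∀ i : Fin k, Matrix (Fin (p i)) (Fin (s i.castSucc)) ℍ[ℝ])
    (C : ∀ i : Fin k, Matrix (Fin (p i)) (Fin (s i.succ)) ℍ[ℝ])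
    (I : Finset (Fin k)) (J : Finset (Fin (k + 1))) :
    Matrix (Σ i : I, Fin (p i)) (Σ j : J, Fin (s j)) ℍ[ℝ] :=
  Matrix.of fun x y => bidiagBlock A C x.1 y.1 x.2 y.2

/-- The block diagonal matrix `diag(E_m, -E_{m+1}, …, (-1)^{n-m} E_n)`. -/
def signedDiag (E : ∀ i : Fin k, Matrix (Fin (p i)) (Fin (p i)) ℍ[ℝ]) (m n : Fin k) :
    Matrix (Σ i : Finset.Icc m n, Fin (p i)) (Σ i : Finset.Icc m n, Fin (p i)) ℍ[ℝ] :=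
  Matrix.blockDiagonal' fun i : Finset.Icc m n =>
    (-1 : ℝ) ^ (((i : Fin k) : ℕ) - (m : ℕ)) • E i

/-- The staircase matrix with the blocks
```
bidiag A C on rows {m, …, n}, columns J       diag(E_m, …, (-1)^{n-m} E_n)
0                                            (bidiag A C on rows {m, …, n}, columns J')^{η*}
```
so that `A_i`, `± E_i`, `C_i` stand in one block row for `m ≤ i ≤ n` (as far as the columns of
`A_i`, `C_i` are in `J`), and the block row `i + 1 ∈ J'` of the lower part has `C_i^{η*}` below
`± E_i` and `A_{i+1}^{η*}` below `± E_{i+1}`. In print the block rows of the upper and lower part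
alternate, and so do the block columns of the left and right part:
```
A_m  E_m        C_m
     C_m^{η*}            A_{m+1}^{η*}
                A_{m+1}  -E_{m+1}         C_{m+1}
                         C_{m+1}^{η*}              ⋱
```
The order of the blocks is immaterial for a matrix indexed by labelled blocks. -/
def staircase (η : ℍ[ℝ])
    (A : ∀ i : Fin k, Matrix (Fin (p i)) (Fin (s i.castSucc)) ℍ[ℝ])
    (C : ∀ i : Fin k, Matrix (Fin (p i)) (Fin (s i.succ)) ℍ[ℝ])
    (E : ∀ i : Fin k, Matrix (Fin (p i)) (Fin (p i)) ℍ[ℝ])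
    (m n : Fin k) (J J' : Finset (Fin (k + 1))) :
    Matrix ((Σ i : Finset.Icc m n, Fin (p i)) ⊕ (Σ j : J', Fin (s j)))
      ((Σ j : J, Fin (s j)) ⊕ (Σ i : Finset.Icc m n, Fin (p i))) ℍ[ℝ] :=
  Matrix.fromBlocks (bidiag A C (Finset.Icc m n) J) (signedDiag E m n)
    0 (etaStar η (bidiag A C (Finset.Icc m n) J'))

end

/-! ### Linear selectors of linear relations, and linear equations solved under a chain of subspace
constraints. -/

section FilteredMaps

variable {K : Type*} [DivisionRing K]

/-! Averaging `X` with `etaStar η X` makes any solution η-Hermitian, so that requirement can be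
dropped. With alternating signs absorbed in `X` and `E`, what remains is a system `A i X i B i + C i
X (i + 1) D i = E i` with `B i` the η-star of `A i` and `D i` minus the η-star of `C i`. If a chain
of vectors satisfies `B i x_i = z_i` and `D i x_i = z_(i+1)`, a solution yields `v_j = X_j z_j` with
`E i x_i = A i v_i + C i v_(i+1)`, and `v` vanishes at an end where `z` does. `ZigzagCondition` asks
for such `v` on an interval of nodes, with either end prescribed to be zero or left free.

These conditions suffice (`exists_zigzag_solution`). The equations are solved from left to right,
and the freedom left at each node is described by a finite increasing chain of pairs `(S, T)`: a map
that sends each `S` into its `T` extends to a homogeneous solution of the earlier equations. Since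
the pairs form a chain, one linear selector serves all of them (`exists_common_selector`), which
solves the next equation under all constraints together. Each vector of an `S` is the endpoint of a
chain of vectors (`isDeterminedModulo_of_mem_zigzagConstraints`), and the zigzag condition for that
chain, prolonged by one step, is what the next equation requires.

For ranks, a block triangular matrix attains the sum of the ranks of its diagonal blocks exactly
when the off-diagonal block maps the kernel of the lower block into the range of the upper one
(`quatRank_fromBlocks_eq_iff`). For the staircase matrices this is a zigzag condition. The listed
equalities give the conditions with a free left end; the others follow by duality, since `E` is
η-Hermitian (`SignedCondition.swap`). -/

/-- Two linear maps that agree on `P ⊓ S` can be glued along `P` and `S`. -/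
theorem LinearMap.exists_eqOn_eqOn {W V : Type*} [AddCommGroup W] [Module K W]
    [AddCommGroup V] [Module K V] (f g : W →ₗ[K] V) (P S : Submodule K W)
    (h : ∀ w ∈ P, w ∈ S → f w = g w) :
    ∃ l : W →ₗ[K] V, (∀ w ∈ P, l w = f w) ∧ ∀ w ∈ S, l w = g w := by
  let f' : W →ₗ.[K] V := ⟨P, f.domRestrict P⟩
  let g' : W →ₗ.[K] V := ⟨S, g.domRestrict S⟩
  have H : ∀ (x : f'.domain) (y : g'.domain), (x : W) = y → f' x = g' y := by
    rintro ⟨x, hx⟩ ⟨y, hy⟩ (rfl : x = y)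
    exact h x hx hy
  obtain ⟨l, hl⟩ := LinearMap.exists_extend (f'.sup g' H).toFun
  have hl' : ∀ z : (f'.sup g' H).domain, l z = f'.sup g' H z := fun z => by
    rw [← LinearPMap.toFun_eq_coe, ← hl]; rfl
  refine ⟨l, fun w hw => ?_, fun w hw => ?_⟩
  · have hz : w ∈ (f'.sup g' H).domain := le_sup_left (a := P) (b := S) hw
    exact (hl' ⟨w, hz⟩).trans ((LinearPMap.left_le_sup f' g' H).2 (x := ⟨w, hw⟩) rfl).symm
  · have hz : w ∈ (f'.sup g' H).domain := le_sup_right (a := P) (b := S) hw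
    exact (hl' ⟨w, hz⟩).trans ((LinearPMap.right_le_sup f' g' H).2 (x := ⟨w, hw⟩) rfl).symm

/-- A linear relation has a linear selector on its domain. -/
theorem Submodule.exists_selector {W V : Type*} [AddCommGroup W] [Module K W]
    [AddCommGroup V] [Module K V] (R : Submodule K (W × V)) :
    ∃ g : W →ₗ[K] V, ∀ w v, (w, v) ∈ R → (w, g w) ∈ R := by
  let π : R →ₗ[K] W := (LinearMap.fst K W V).comp R.subtype
  obtain ⟨σ, hσ⟩ := π.rangeRestrict.exists_rightInverse_of_surjective π.range_rangeRestrict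
  obtain ⟨g, hg⟩ := LinearMap.exists_extend
    ((LinearMap.snd K W V).comp (R.subtype.comp σ))
  refine ⟨g, fun w v hwv => ?_⟩
  have hw : w ∈ LinearMap.range π := ⟨⟨_, hwv⟩, rfl⟩
  have h1 : g w = ((σ ⟨w, hw⟩ : R) : W × V).2 := LinearMap.congr_fun hg ⟨w, hw⟩
  have h2 : ((σ ⟨w, hw⟩ : R) : W × V).1 = w :=
    congrArg Subtype.val (LinearMap.congr_fun hσ ⟨w, hw⟩)
  have h3 : (w, g w) = ((σ ⟨w, hw⟩ : R) : W × V) := Prod.ext h2.symm h1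
  rw [h3]
  exact (σ ⟨w, hw⟩).2

/-- A partial linear selector of a linear relation extends to the whole domain. -/
theorem Submodule.exists_selector_extend {W V : Type*} [AddCommGroup W] [Module K W]
    [AddCommGroup V] [Module K V] (R : Submodule K (W × V)) (P : Submodule K W) (f : W →ₗ[K] V)
    (hf : ∀ w ∈ P, ∀ v, (w, v) ∈ R → (w, f w) ∈ R) :
    ∃ g : W →ₗ[K] V, (∀ w ∈ P, g w = f w) ∧ ∀ w v, (w, v) ∈ R → (w, g w) ∈ R := by
  obtain ⟨g₀, hg₀⟩ := R.exists_selector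
  -- `S` is the domain of `R`, and `T` is its indeterminacy: two values of `R` at one point differ
  -- by an element of `T`. So `f - g₀` is `T`-valued on `P ⊓ S`, and it suffices to correct `g₀` by
  -- a map that is `f - g₀` on `P` and `T`-valued on `S`.
  let S : Submodule K W := R.map (LinearMap.fst K W V)
  let T : Submodule K V := R.comap (LinearMap.inr K W V)
  have hd : ∀ x : ↥(P ⊓ S), (f - g₀) x ∈ T := by
    rintro ⟨w, hP, ⟨⟨_, v⟩, hv, rfl⟩⟩
    have := R.sub_mem (hf _ hP v hv) (hg₀ _ v hv)
    simpa [T] using this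
  obtain ⟨e, he⟩ := LinearMap.exists_extend (((f - g₀).domRestrict (P ⊓ S)).codRestrict T hd)
  obtain ⟨l, hlP, hlS⟩ := LinearMap.exists_eqOn_eqOn (f - g₀) (T.subtype.comp e) P S
    (fun w hP hS => (congrArg Subtype.val (LinearMap.congr_fun he ⟨w, hP, hS⟩)).symm)
  refine ⟨g₀ + l, fun w hw => by simp [hlP w hw], fun w v hwv => ?_⟩
  have h1 : (0, l w) ∈ R := by
    rw [hlS w ⟨_, hwv, rfl⟩]
    exact (e w).2
  have := R.add_mem (hg₀ w v hwv) h1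
  simpa using this

/-- An increasing list of linear relations has a common linear selector that extends a given
partial one. -/
theorem exists_common_selector {W V : Type*} [AddCommGroup W] [Module K W]
    [AddCommGroup V] [Module K V] (L : List (Submodule K (W × V))) (hL : L.Pairwise (· ≤ ·))
    (P : Submodule K W) (f : W →ₗ[K] V)
    (hf : ∀ R ∈ L, ∀ w ∈ P, ∀ v, (w, v) ∈ R → (w, f w) ∈ R) :
    ∃ g : W →ₗ[K] V, (∀ w ∈ P, g w = f w) ∧ ∀ R ∈ L, ∀ w v, (w, v) ∈ R → (w, g w) ∈ R := by
  induction L generalizing P f with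
  | nil => exact ⟨f, fun _ _ => rfl, by simp⟩
  | cons R L ih =>
    obtain ⟨hR, hL⟩ := List.pairwise_cons.1 hL
    obtain ⟨h, hP, hS⟩ := R.exists_selector_extend P f (hf R (by simp))
    -- The smallest relation is served first, and its domain joins `P`. The values chosen there lie
    -- in `R ≤ R'`, so they stay admissible for every later relation.
    obtain ⟨g, hg, hgL⟩ := ih hL (P ⊔ R.map (LinearMap.fst K W V)) h (by
      intro R' hR' w hw v hv
      obtain ⟨a, ha, b, ⟨⟨b, c⟩, hc, rfl⟩, rfl⟩ := Submodule.mem_sup.1 hw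
      have h1 : (b, h b) ∈ R' := hR R' hR' (hS b c hc)
      have h2 : (a, v - c) ∈ R' := by
        have := R'.sub_mem hv (hR R' hR' hc)
        simpa using this
      have h3 := hf R' (by simp [hR']) a ha _ h2
      rw [← hP a ha] at h3
      have := R'.add_mem h3 h1
      simpa using this)
    refine ⟨g, fun w hw => (hg w (Submodule.mem_sup_left hw)).trans (hP w hw), ?_⟩
    intro R' hR' w v hv
    rcases List.mem_cons.1 hR' with rfl | hR'
    · rw [hg w (Submodule.mem_sup_right ⟨_, hv, rfl⟩)]
      exact hS w v hv
    · exact hgL R' hR' w v hv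

variable {V V' U U' : Type*} [AddCommGroup V] [Module K V] [AddCommGroup V'] [Module K V']
  [AddCommGroup U] [Module K U] [AddCommGroup U'] [Module K U']

/-- The relation of all `(B u, v)` with `u ∈ S`, `v ∈ T` and `A v - Y u ∈ T₀`. -/
def liftRelation (A : V →ₗ[K] U) (B : U' →ₗ[K] V') (Y : U' →ₗ[K] U)
    (S : Submodule K U') (T : Submodule K V) (T₀ : Submodule K U) : Submodule K (V' × V) :=
  ((S.prod T) ⊓ T₀.comap (A.comp (LinearMap.snd K U' V) - Y.comp (LinearMap.fst K U' V))).map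
    (B.prodMap LinearMap.id)

theorem mem_liftRelation {A : V →ₗ[K] U} {B : U' →ₗ[K] V'} {Y : U' →ₗ[K] U}
    {S : Submodule K U'} {T : Submodule K V} {T₀ : Submodule K U} {w : V'} {v : V} :
    (w, v) ∈ liftRelation A B Y S T T₀ ↔ ∃ u ∈ S, v ∈ T ∧ A v - Y u ∈ T₀ ∧ B u = w := by
  constructor
  · rintro ⟨⟨u, v'⟩, ⟨⟨hu, hv⟩, h⟩, h'⟩
    obtain ⟨rfl, rfl⟩ := Prod.ext_iff.1 h'
    exact ⟨u, hu, hv, h, rfl⟩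
  · rintro ⟨u, hu, hv, h, rfl⟩
    exact ⟨⟨u, v⟩, ⟨⟨hu, hv⟩, h⟩, rfl⟩

theorem liftRelation_mono {A : V →ₗ[K] U} {B : U' →ₗ[K] V'} {Y : U' →ₗ[K] U}
    {S S' : Submodule K U'} {T T' : Submodule K V} {T₀ T₀' : Submodule K U}
    (hS : S ≤ S') (hT : T ≤ T') (hT₀ : T₀ ≤ T₀') :
    liftRelation A B Y S T T₀ ≤ liftRelation A B Y S' T' T₀' :=
  Submodule.map_mono (inf_le_inf (Submodule.prod_mono hS hT) (Submodule.comap_mono hT₀))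

/-- For an increasing list of pairs `(S, T)` that begins with zero and ends with the whole spaces,
`A X B = Y` is solvable by a map `X` with `X S ≤ T` for all pairs of the list as soon as `Y` maps
`B⁻¹ S` into `A T` for all of them. -/
theorem exists_filtered_solution (A : V →ₗ[K] U) (B : U' →ₗ[K] V') (Y : U' →ₗ[K] U)
    (L : List (Submodule K V' × Submodule K V)) (hL : L.Pairwise (· ≤ ·))
    (hbot : (⊥, ⊥) ∈ L) (htop : (⊤, ⊤) ∈ L)
    (hY : ∀ q ∈ L, ∀ u, B u ∈ q.1 → Y u ∈ q.2.map A) :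
    ∃ X : V' →ₗ[K] V, (∀ q ∈ L, ∀ w ∈ q.1, X w ∈ q.2) ∧ ∀ u, A (X (B u)) = Y u := by
  have hker : ∀ u, B u = 0 → Y u = 0 := fun u hu => by
    simpa using hY _ hbot u (by simpa using hu)
  -- First only the values on `range B` are chosen, as solutions of `A v = Y u` with `v` in the
  -- prescribed subspace; the pair `(⊥, ⊥)` makes `Y u` depend on `B u` alone.
  obtain ⟨f, -, hf⟩ := exists_common_selector
    (L.map fun q => liftRelation A B Y (q.1.comap B) q.2 ⊥)
    (hL.map _ fun q q' h => liftRelation_mono (Submodule.comap_mono h.1) h.2 le_rfl) ⊥ 0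
    (by
      intro R hR w hw v hv
      obtain ⟨q, hq, rfl⟩ := List.mem_map.1 hR
      obtain ⟨u, hu, -, h, rfl⟩ := mem_liftRelation.1 hv
      have hu0 : B u = 0 := by simpa using hw
      refine mem_liftRelation.2 ⟨u, hu, by simp, by simp [hker u hu0], rfl⟩)
  have hf' : ∀ q ∈ L, ∀ u, B u ∈ q.1 → f (B u) ∈ q.2 ∧ A (f (B u)) = Y u := by
    intro q hq u hu
    obtain ⟨v, hv, hvu⟩ := hY q hq u hu
    obtain ⟨u', -, h1, h2, h3⟩ := mem_liftRelation.1 (hf _ (List.mem_map_of_mem hq) (B u) v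
      (mem_liftRelation.2 ⟨u, hu, hv, by simp [hvu], rfl⟩))
    refine ⟨h1, ?_⟩
    have h4 := hker (u - u') (by simp [h3])
    rw [map_sub, sub_eq_zero] at h4
    rw [h4]
    simpa [sub_eq_zero] using h2
  -- The map is now extended from `range B` to all of `V'`, keeping the inclusions `S → T`.
  obtain ⟨X, hX, hXL⟩ := exists_common_selector
    (L.map fun q => q.1.prod q.2) (hL.map _ fun q q' h => Submodule.prod_mono h.1 h.2)
    (LinearMap.range B) f (by
      rintro R hR _ ⟨u, rfl⟩ v hv
      obtain ⟨q, hq, rfl⟩ := List.mem_map.1 hR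
      exact ⟨hv.1, (hf' q hq u hv.1).1⟩)
  refine ⟨X, fun q hq w hw => ?_, fun u => ?_⟩
  · exact (hXL _ (List.mem_map_of_mem hq) w 0 ⟨hw, q.2.zero_mem⟩).2
  · rw [hX _ ⟨u, rfl⟩]
    exact (hf' _ htop u trivial).2

/-- Modulo an increasing list of pairs `(S, T)` the map `E` is of the form `C X D`, provided that
it is on each pair, as far as kernel and range are concerned. -/
theorem exists_solution_modulo (C : V →ₗ[K] U) (D : U' →ₗ[K] V') (E : U' →ₗ[K] U)
    (L : List (Submodule K U' × Submodule K U)) (hL : L.Pairwise (· ≤ ·))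
    (hker : ∀ q ∈ L, ∀ u ∈ q.1, D u = 0 → E u ∈ q.2)
    (hrange : ∀ q ∈ L, ∀ u ∈ q.1, ∃ v, E u - C v ∈ q.2) :
    ∃ X : V' →ₗ[K] V, ∀ q ∈ L, ∀ u ∈ q.1, E u - C (X (D u)) ∈ q.2 := by
  obtain ⟨X, -, hX⟩ := exists_common_selector
    (L.map fun q => liftRelation C D E q.1 ⊤ q.2)
    (hL.map _ fun q q' h => liftRelation_mono h.1 le_rfl h.2) ⊥ 0
    (by
      intro R hR w hw v hv
      rw [(Submodule.mem_bot K).1 hw]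
      exact R.zero_mem)
  refine ⟨X, fun q hq u hu => ?_⟩
  obtain ⟨v, hv⟩ := hrange q hq u hu
  obtain ⟨u', hu', -, h1, h2⟩ := mem_liftRelation.1 (hX _ (List.mem_map_of_mem hq) (D u) v
    (mem_liftRelation.2 ⟨u, hu, trivial, by simpa using q.2.neg_mem hv, rfl⟩))
  -- The selector refers to some `u'` with `D u' = D u`; the kernel hypothesis makes the change from
  -- `u'` to `u` harmless modulo `q.2`.
  have h3 := hker q hq (u - u') (q.1.sub_mem hu hu') (by simp [h2])
  have := q.2.sub_mem h3 h1
  have h4 : E u - C (X (D u)) = E (u - u') - (C (X (D u)) - E u') := by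
    rw [map_sub]; abel
  rwa [h4]

end FilteredMaps

/-! ### Chains of two-sided linear equations over a division ring. -/

section ZigzagSystem

variable {K : Type*} [DivisionRing K] {k : ℕ}
  {V V' : Fin (k + 1) → Type*} {U U' : Fin k → Type*}
  [∀ j, AddCommGroup (V j)] [∀ j, Module K (V j)] [∀ j, AddCommGroup (V' j)] [∀ j, Module K (V' j)]
  [∀ i, AddCommGroup (U i)] [∀ i, Module K (U i)] [∀ i, AddCommGroup (U' i)] [∀ i, Module K (U' i)]

/-- The increasing list of pairs `(S, T)` of subspaces that describes which `X j` occur in the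
solutions of the homogeneous equations `A i X i B i + C i X (i + 1) D i = 0`, `i < j`: they are
those that map `S` into `T` for all pairs of the list. -/
def zigzagConstraints (A : ∀ i : Fin k, V i.castSucc →ₗ[K] U i) (C : ∀ i : Fin k, V i.succ →ₗ[K] U i)
    (B : ∀ i : Fin k, U' i →ₗ[K] V' i.castSucc) (D : ∀ i : Fin k, U' i →ₗ[K] V' i.succ) :
    ∀ j : Fin (k + 1), List (Submodule K (V' j) × Submodule K (V j)) :=
  Fin.induction [(⊥, ⊥), (⊤, ⊤)] fun i L =>
    (⊥, ⊥) :: (L.map fun q => ((q.1.comap (B i)).map (D i), (q.2.map (A i)).comap (C i))) ++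
      [(⊤, ⊤)]

variable {A : ∀ i : Fin k, V i.castSucc →ₗ[K] U i} {C : ∀ i : Fin k, V i.succ →ₗ[K] U i}
  {B : ∀ i : Fin k, U' i →ₗ[K] V' i.castSucc} {D : ∀ i : Fin k, U' i →ₗ[K] V' i.succ}

theorem zigzagConstraints_zero :
    zigzagConstraints A C B D 0 = [(⊥, ⊥), (⊤, ⊤)] := rfl

theorem zigzagConstraints_succ (i : Fin k) :
    zigzagConstraints A C B D i.succ = (⊥, ⊥) :: ((zigzagConstraints A C B D i.castSucc).map
      fun q => ((q.1.comap (B i)).map (D i), (q.2.map (A i)).comap (C i))) ++ [(⊤, ⊤)] :=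
  Fin.induction_succ ..

theorem bot_mem_zigzagConstraints (j : Fin (k + 1)) : (⊥, ⊥) ∈ zigzagConstraints A C B D j := by
  cases j using Fin.cases <;> simp [zigzagConstraints_zero, zigzagConstraints_succ]

theorem top_mem_zigzagConstraints (j : Fin (k + 1)) : (⊤, ⊤) ∈ zigzagConstraints A C B D j := by
  cases j using Fin.cases <;> simp [zigzagConstraints_zero, zigzagConstraints_succ]

theorem pairwise_zigzagConstraints (j : Fin (k + 1)) :
    (zigzagConstraints A C B D j).Pairwise (· ≤ ·) := by
  induction j using Fin.induction with
  | zero => simp [zigzagConstraints_zero, Prod.le_def]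
  | succ i ih =>
    rw [zigzagConstraints_succ, List.cons_append, List.pairwise_cons, List.pairwise_append]
    refine ⟨fun q _ => ⟨bot_le, bot_le⟩, ih.map _ fun q q' h => ?_, by simp, fun q _ q' hq' => ?_⟩
    · exact ⟨Submodule.map_mono (Submodule.comap_mono h.1),
        Submodule.comap_mono (Submodule.map_mono h.2)⟩
    · rw [List.mem_singleton.1 hq']
      exact ⟨le_top, le_top⟩

/-- All maps that satisfy the constraints at `j` occur in solutions of the homogeneous
equations before `j`. -/
theorem exists_homogeneous_zigzag_solution (j : Fin (k + 1)) (Z : V' j →ₗ[K] V j)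
    (hZ : ∀ q ∈ zigzagConstraints A C B D j, ∀ w ∈ q.1, Z w ∈ q.2) :
    ∃ X : ∀ j, V' j →ₗ[K] V j, X j = Z ∧ ∀ i : Fin k, i.castSucc < j → ∀ u,
      A i (X i.castSucc (B i u)) + C i (X i.succ (D i u)) = 0 := by
  induction j using Fin.induction with
  | zero => exact ⟨Function.update 0 0 Z, by simp, fun i hi => absurd hi (Fin.not_lt_zero _)⟩
  -- The constraint on `Z` transported from `(S, T)` says precisely that `-C Z D` maps `B⁻¹ S` into
  -- `A T`, which is the condition for solving `A Z₀ B = -C Z D` with `Z₀ S ≤ T`.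
  | succ i ih =>
    obtain ⟨Z₀, hZ₀, hZA⟩ := exists_filtered_solution (A i) (B i) (-((C i).comp (Z.comp (D i))))
      (zigzagConstraints A C B D i.castSucc) (pairwise_zigzagConstraints _)
      (bot_mem_zigzagConstraints _) (top_mem_zigzagConstraints _) (fun q hq u hu => by
        refine Submodule.neg_mem _ (Submodule.mem_comap.1
          (hZ ((q.1.comap (B i)).map (D i), (q.2.map (A i)).comap (C i)) ?_ (D i u) ⟨u, hu, rfl⟩))
        rw [zigzagConstraints_succ]
        exact List.mem_append_left _ (List.mem_cons_of_mem _ (List.mem_map_of_mem hq)))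
    obtain ⟨X, hX, hXe⟩ := ih Z₀ hZ₀
    refine ⟨Function.update X i.succ Z, by simp, fun i' hi' u => ?_⟩
    have hc : i'.castSucc ≠ i.succ := hi'.ne
    rw [Function.update_of_ne hc]
    by_cases h : i' = i
    · subst h
      rw [Function.update_self, hX, hZA]
      simp
    · have hlt : i' < i := by
        have : i' ≤ i := Fin.castSucc_lt_succ_iff.1 hi'
        exact lt_of_le_of_ne this h
      rw [Function.update_of_ne (fun e => h (Fin.succ_injective _ e))]
      exact hXe i' (Fin.castSucc_lt_castSucc_iff.2 hlt) u

/-- The solvability condition on the part of the system between the nodes `l` and `r`, with the end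
nodes removed on the left side or on the right side of the unknowns according to `a` and `b`. -/
def ZigzagCondition (A : ∀ i : Fin k, V i.castSucc →ₗ[K] U i) (C : ∀ i : Fin k, V i.succ →ₗ[K] U i)
    (B : ∀ i : Fin k, U' i →ₗ[K] V' i.castSucc) (D : ∀ i : Fin k, U' i →ₗ[K] V' i.succ)
    (E : ∀ i : Fin k, U' i →ₗ[K] U i) (l r : Fin (k + 1)) (a b : Prop) : Prop :=
  ∀ (x : ∀ i, U' i) (z : ∀ j, V' j),
    (∀ i : Fin k, l ≤ i.castSucc → i.succ ≤ r → B i (x i) = z i.castSucc ∧ D i (x i) = z i.succ) →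
    (a → z l = 0) → (b → z r = 0) →
    ∃ v : ∀ j, V j, (a → v l = 0) ∧ (b → v r = 0) ∧
      ∀ i : Fin k, l ≤ i.castSucc → i.succ ≤ r →
        E i (x i) = A i (v i.castSucc) + C i (v i.succ)

/-- There is a chain of vectors ending at `w`, along which the value at `w` of the solutions of the
equations before `j` is determined modulo `T`. -/
def IsDeterminedModulo (A : ∀ i : Fin k, V i.castSucc →ₗ[K] U i)
    (C : ∀ i : Fin k, V i.succ →ₗ[K] U i) (B : ∀ i : Fin k, U' i →ₗ[K] V' i.castSucc)
    (D : ∀ i : Fin k, U' i →ₗ[K] V' i.succ) (E : ∀ i : Fin k, U' i →ₗ[K] U i) (j : Fin (k + 1))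
    (w : V' j) (T : Submodule K (V j)) : Prop :=
  ∃ (l : Fin (k + 1)) (a : Prop) (x : ∀ i, U' i) (z : ∀ j, V' j), l ≤ j ∧
    (∀ i : Fin k, l ≤ i.castSucc → i.succ ≤ j →
      B i (x i) = z i.castSucc ∧ D i (x i) = z i.succ) ∧
    (a → z l = 0) ∧ z j = w ∧
    ∀ X : ∀ j, V' j →ₗ[K] V j,
      (∀ i : Fin k, i.castSucc < j → ∀ u,
        A i (X i.castSucc (B i u)) + C i (X i.succ (D i u)) = E i u) →
      ∀ v : ∀ j, V j, (a → v l = 0) →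
        (∀ i : Fin k, l ≤ i.castSucc → i.succ ≤ j →
          E i (x i) = A i (v i.castSucc) + C i (v i.succ)) →
        v j - X j w ∈ T

/-- Every vector of a constraint space is determined modulo its companion. -/
theorem isDeterminedModulo_of_mem_zigzagConstraints (E : ∀ i : Fin k, U' i →ₗ[K] U i)
    (j : Fin (k + 1)) (q : Submodule K (V' j) × Submodule K (V j)) (hq : q ∈ zigzagConstraints A C B D j)
    (w : V' j) (hw : w ∈ q.1) :
    IsDeterminedModulo A C B D E j w q.2 := by
  have hnil : ∀ (j : Fin (k + 1)) (i : Fin k), j ≤ i.castSucc → i.succ ≤ j → False :=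
    fun j i h1 h2 => absurd (h2.trans h1) (not_le.2 Fin.castSucc_lt_succ)
  have hbot : ∀ j : Fin (k + 1), ∀ w ∈ (⊥ : Submodule K (V' j)),
      IsDeterminedModulo A C B D E j w ⊥ := by
    intro j w hw
    rw [Submodule.mem_bot] at hw
    subst hw
    -- The chain consists of the single node `j`, its end being prescribed as zero; for `⊤` below,
    -- the same chain has a free end.
    refine ⟨j, True, 0, 0, le_rfl, fun i h1 h2 => (hnil j i h1 h2).elim, fun _ => rfl, rfl, ?_⟩
    intro X _ v hv _
    simp [hv trivial]
  have htop : ∀ j : Fin (k + 1), ∀ w : V' j,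
      IsDeterminedModulo A C B D E j w ⊤ := by
    intro j w
    exact ⟨j, False, 0, Function.update 0 j w, le_rfl, fun i h1 h2 => (hnil j i h1 h2).elim,
      False.elim, by simp, fun _ _ _ _ _ => trivial⟩
  induction j using Fin.induction with
  | zero =>
    rw [zigzagConstraints_zero] at hq
    rcases List.mem_cons.1 hq with rfl | hq
    · exact hbot _ w hw
    · obtain rfl := List.mem_singleton.1 hq
      exact htop _ w
  | succ i ih =>
    rw [zigzagConstraints_succ, List.cons_append] at hq
    rcases List.mem_cons.1 hq with rfl | hq
    · exact hbot _ w hw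
    rcases List.mem_append.1 hq with hq | hq
    swap
    · obtain rfl := List.mem_singleton.1 hq
      exact htop _ w
    obtain ⟨q₀, hq₀, rfl⟩ := List.mem_map.1 hq
    obtain ⟨u, hu, rfl⟩ := hw
    obtain ⟨l, a, x, z, hl, hxz, hz, hzj, hX⟩ := ih q₀ hq₀ (B i u) hu
    have hli : l ≠ i.succ := (hl.trans_lt Fin.castSucc_lt_succ).ne
    refine ⟨l, a, Function.update x i u, Function.update z i.succ (D i u),
      hl.trans Fin.castSucc_lt_succ.le, fun i' h1 h2 => ?_, fun ha => ?_, by simp, ?_⟩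
    · have hle : i' ≤ i := Fin.succ_le_succ_iff.1 h2
      have hc : i'.castSucc ≠ i.succ := (Fin.castSucc_lt_succ_iff.2 hle).ne
      rw [Function.update_of_ne hc]
      by_cases h : i' = i
      · subst h
        simp [hzj]
      · rw [Function.update_of_ne h, Function.update_of_ne (fun e => h (Fin.succ_injective _ e))]
        exact hxz i' h1 (Fin.succ_le_castSucc_iff.2 (lt_of_le_of_ne hle h))
    · rw [Function.update_of_ne hli]
      exact hz ha
    · intro X hXe v hv hvE
      have h1 := hX X (fun i' hi' => hXe i' (hi'.trans Fin.castSucc_lt_succ)) v hv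
        (fun i' h1 h2 => by
          have := hvE i' h1 (h2.trans Fin.castSucc_lt_succ.le)
          rwa [Function.update_of_ne (Fin.succ_le_castSucc_iff.1 h2).ne] at this)
      have h2 := hvE i hl le_rfl
      rw [Function.update_self, ← hXe i Fin.castSucc_lt_succ u] at h2
      -- Both `v` and the solution `X` express `E i u`. Subtracting, `C` of the discrepancy at `i +
      -- 1` is minus `A` of the discrepancy at `i`, which lies in `A T` by induction.
      refine ⟨-(v i.castSucc - X i.castSucc (B i u)), q₀.2.neg_mem h1, ?_⟩
      simp only [map_neg, map_sub]
      rw [← sub_eq_zero] at h2 ⊢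
      rw [← h2]
      abel

/-- The system `A i X i B i + C i X (i + 1) D i = E i` of linear maps is solvable if and only if
its connected parts satisfy the solvability conditions for all four kinds of ends. -/
theorem exists_zigzag_solution (E : ∀ i : Fin k, U' i →ₗ[K] U i)
    (h : ∀ l r : Fin (k + 1), l < r → ∀ a b : Prop, ZigzagCondition A C B D E l r a b) :
    ∃ X : ∀ j, V' j →ₗ[K] V j, ∀ i : Fin k, ∀ u,
      A i (X i.castSucc (B i u)) + C i (X i.succ (D i u)) = E i u := by
  suffices H : ∀ j : Fin (k + 1), ∃ X : ∀ j, V' j →ₗ[K] V j, ∀ i : Fin k, i.castSucc < j → ∀ u,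
      A i (X i.castSucc (B i u)) + C i (X i.succ (D i u)) = E i u by
    obtain ⟨X, hX⟩ := H (Fin.last k)
    exact ⟨X, fun i => hX i (Fin.castSucc_lt_last i)⟩
  intro j
  induction j using Fin.induction with
  | zero => exact ⟨0, fun i hi => absurd hi (Fin.not_lt_zero _)⟩
  | succ i ih =>
    obtain ⟨X, hX⟩ := ih
    -- The earlier solution `X` is to be changed by a homogeneous one with value `Z` at node `i`, so
    -- the task is `A Z B + C X' D = E'` with `Z` subject to the constraints.
    set E' : U' i →ₗ[K] U i := E i - (A i).comp ((X i.castSucc).comp (B i)) with hE'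
    -- The zigzag condition is applied to the chain that ends at `B i u`, prolonged by `u`. A zero
    -- right end (`b` true) gives the kernel hypothesis for `X'`, a free one the range hypothesis.
    have key : ∀ (b : Prop), ∀ q ∈ zigzagConstraints A C B D i.castSucc, ∀ u, B i u ∈ q.1 →
        (b → D i u = 0) → ∃ v, (b → v = 0) ∧ E' u - C i v ∈ q.2.map (A i) := by
      intro b q hq u hu hb
      obtain ⟨l, a, x, z, hl, hxz, hz, hzj, hT⟩ :=
        isDeterminedModulo_of_mem_zigzagConstraints E _ q hq (B i u) hu
      have hli : l ≠ i.succ := (hl.trans_lt Fin.castSucc_lt_succ).ne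
      obtain ⟨v, hva, hvb, hv⟩ := h l i.succ (hl.trans_lt Fin.castSucc_lt_succ) a b
        (Function.update x i u) (Function.update z i.succ (D i u)) (fun i' h1 h2 => by
          have hle : i' ≤ i := Fin.succ_le_succ_iff.1 h2
          have hc : i'.castSucc ≠ i.succ := (Fin.castSucc_lt_succ_iff.2 hle).ne
          rw [Function.update_of_ne hc]
          by_cases h : i' = i
          · subst h
            simp [hzj]
          · rw [Function.update_of_ne h,
              Function.update_of_ne (fun e => h (Fin.succ_injective _ e))]
            exact hxz i' h1 (Fin.succ_le_castSucc_iff.2 (lt_of_le_of_ne hle h)))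
        (by rwa [Function.update_of_ne hli]) (by simpa using hb)
      refine ⟨v i.succ, hvb, v i.castSucc - X i.castSucc (B i u), hT X hX v hva
        (fun i' h1 h2 => by
          have := hv i' h1 (h2.trans Fin.castSucc_lt_succ.le)
          rwa [Function.update_of_ne (Fin.succ_le_castSucc_iff.1 h2).ne] at this), ?_⟩
      have h2 := hv i hl le_rfl
      rw [Function.update_self] at h2
      simp only [hE', map_sub, LinearMap.sub_apply, LinearMap.comp_apply, h2]
      abel
    obtain ⟨X', hX'⟩ := exists_solution_modulo (C i) (D i) E'
      ((zigzagConstraints A C B D i.castSucc).map fun q => (q.1.comap (B i), q.2.map (A i)))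
      ((pairwise_zigzagConstraints _).map _ fun q q' h =>
        ⟨Submodule.comap_mono h.1, Submodule.map_mono h.2⟩)
      (by
        intro q hq u hu hDu
        obtain ⟨q₀, hq₀, rfl⟩ := List.mem_map.1 hq
        obtain ⟨v, hv, hv'⟩ := key True q₀ hq₀ u hu fun _ => hDu
        simpa [hv trivial] using hv')
      (by
        intro q hq u hu
        obtain ⟨q₀, hq₀, rfl⟩ := List.mem_map.1 hq
        obtain ⟨v, -, hv⟩ := key False q₀ hq₀ u hu False.elim
        exact ⟨v, hv⟩)
    -- `X'` was chosen so that the remainder `E' - C X' D` maps each `B⁻¹ S` into `A T`; hence a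
    -- constrained `Z` can absorb it.
    obtain ⟨Z, hZ, hZA⟩ := exists_filtered_solution (A i) (B i) (E' - (C i).comp (X'.comp (D i)))
      (zigzagConstraints A C B D i.castSucc) (pairwise_zigzagConstraints _)
      (bot_mem_zigzagConstraints _) (top_mem_zigzagConstraints _)
      (fun q hq u hu => hX' _ (List.mem_map_of_mem hq) u hu)
    obtain ⟨X₁, hX₁, hX₁e⟩ := exists_homogeneous_zigzag_solution i.castSucc Z hZ
    refine ⟨Function.update (X + X₁) i.succ X', fun i' hi' u => ?_⟩
    have hc : i'.castSucc ≠ i.succ := hi'.ne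
    rw [Function.update_of_ne hc]
    by_cases h : i' = i
    · subst h
      rw [Function.update_self, Pi.add_apply, hX₁, LinearMap.add_apply, map_add, hZA]
      simp only [hE', LinearMap.sub_apply, LinearMap.comp_apply]
      abel
    · have hlt : i'.castSucc < i.castSucc :=
        Fin.castSucc_lt_castSucc_iff.2 (lt_of_le_of_ne (Fin.castSucc_lt_succ_iff.1 hi') h)
      rw [Function.update_of_ne (fun e => h (Fin.succ_injective _ e))]
      have h1 := hX i' hlt u
      have h2 := hX₁e i' hlt u
      simp only [Pi.add_apply, LinearMap.add_apply, map_add]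
      rw [← h1, ← add_zero (A i' _ + C i' (X _ _)), ← h2]
      abel

/-- A solvable system satisfies the solvability conditions. -/
theorem zigzagCondition_of_solution (E : ∀ i : Fin k, U' i →ₗ[K] U i)
    (X : ∀ j, V' j →ₗ[K] V j)
    (hX : ∀ i : Fin k, ∀ u, A i (X i.castSucc (B i u)) + C i (X i.succ (D i u)) = E i u)
    (l r : Fin (k + 1)) (a b : Prop) : ZigzagCondition A C B D E l r a b := by
  intro x z hxz ha hb
  refine ⟨fun j => X j (z j), fun h => by simp [ha h], fun h => by simp [hb h],
    fun i h1 h2 => ?_⟩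
  rw [← hX, (hxz i h1 h2).1, (hxz i h1 h2).2]

end ZigzagSystem

/-! ### Kernels, column spaces and ranks of quaternion matrices as right linear maps. -/

section QuaternionMatrix

instance finite_quaternion_mulOpposite : Module.Finite (ℍ[ℝ])ᵐᵒᵖ ℍ[ℝ] := by
  refine ⟨⟨{1}, ?_⟩⟩
  rw [eq_top_iff]
  intro q _
  rw [Finset.coe_singleton, Submodule.mem_span_singleton]
  exact ⟨MulOpposite.op q, by simp⟩

variable {m n l o : Type*}

/-- The right linear map `v ↦ M v` of a quaternion matrix. -/
noncomputable def colMap [Fintype n] (M : Matrix m n ℍ[ℝ]) : (n → ℍ[ℝ]) →ₗ[(ℍ[ℝ])ᵐᵒᵖ] (m → ℍ[ℝ]) :=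
  Matrix.mulVecBilin ℍ[ℝ] (ℍ[ℝ])ᵐᵒᵖ M

@[simp]
theorem colMap_apply [Fintype n] (M : Matrix m n ℍ[ℝ]) (v : n → ℍ[ℝ]) : colMap M v = M *ᵥ v := rfl

theorem exists_eq_colMap [Fintype n] (f : (n → ℍ[ℝ]) →ₗ[(ℍ[ℝ])ᵐᵒᵖ] (m → ℍ[ℝ])) :
    ∃ M : Matrix m n ℍ[ℝ], f = colMap M := by
  classical
  refine ⟨Matrix.of fun i j => f (Pi.single j 1) i, LinearMap.pi_ext' fun j => ?_⟩
  refine LinearMap.ext_ring_op (funext fun i => ?_)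
  simp

theorem range_colMap [Fintype n] (M : Matrix m n ℍ[ℝ]) :
    LinearMap.range (colMap M) = Submodule.span (ℍ[ℝ])ᵐᵒᵖ (Set.range M.col) := by
  classical
  apply le_antisymm
  · rintro _ ⟨v, rfl⟩
    rw [colMap_apply, Matrix.mulVec_eq_sum]
    exact Submodule.sum_mem _ fun i _ =>
      Submodule.smul_mem _ _ (Submodule.subset_span ⟨i, rfl⟩)
  · rw [Submodule.span_le]
    rintro _ ⟨j, rfl⟩
    exact ⟨Pi.single j 1, by simp⟩

theorem quatRank_eq_finrank_range [Fintype n] (M : Matrix m n ℍ[ℝ]) :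
    quatRank M = Module.finrank (ℍ[ℝ])ᵐᵒᵖ (LinearMap.range (colMap M)) := by
  rw [quatRank, range_colMap]

/-- The column space of a quaternion matrix is the annihilator of its left kernel. -/
theorem exists_mulVec_eq_of_forall_vecMul_eq_zero [Fintype m] [Fintype n] (N : Matrix m n ℍ[ℝ])
    (z : m → ℍ[ℝ]) (h : ∀ y : m → ℍ[ℝ], y ᵥ* N = 0 → y ⬝ᵥ z = 0) : ∃ v, z = N *ᵥ v := by
  classical
  by_contra hz
  have hz' : z ∉ LinearMap.range (colMap N) := fun ⟨v, hv⟩ => hz ⟨v, hv.symm⟩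
  obtain ⟨f, hfz, hf⟩ := Submodule.exists_le_ker_of_notMem hz'
  -- A right linear functional that separates `z` from the column space is multiplication by a row
  -- `y` from the left.
  let y : m → ℍ[ℝ] := fun i => (f (Pi.single i 1)).unop
  have hy : ∀ v, f v = MulOpposite.op (y ⬝ᵥ v) := by
    intro v
    have hv : v = ∑ i, MulOpposite.op (v i) • Pi.single i (1 : ℍ[ℝ]) := by
      ext1 j
      simp [Finset.sum_apply, Pi.single_apply]
    conv_lhs => rw [hv]
    simp [dotProduct, y]
  refine hfz ?_
  rw [hy, h y, MulOpposite.op_zero]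
  ext1 j
  have h1 := LinearMap.mem_ker.1 (hf ⟨Pi.single j 1, rfl⟩)
  rw [hy, colMap_apply, MulOpposite.op_eq_zero_iff, Matrix.dotProduct_mulVec] at h1
  simpa using h1

/-- A block triangular matrix has the least possible rank if and only if its off-diagonal block
maps the kernel of the lower block into the column space of the upper one. -/
theorem quatRank_fromBlocks_eq_iff [Fintype m] [Fintype n] [Fintype l] [Fintype o]
    (N : Matrix m n ℍ[ℝ]) (F : Matrix m o ℍ[ℝ]) (N' : Matrix l o ℍ[ℝ]) :
    quatRank (Matrix.fromBlocks N F 0 N') = quatRank N + quatRank N' ↔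
      ∀ x, N' *ᵥ x = 0 → ∃ v, F *ᵥ x = N *ᵥ v := by
  let φ := colMap (Matrix.fromBlocks N F 0 N')
  have hφ : ∀ x, x ∈ LinearMap.ker φ ↔
      N *ᵥ (x ∘ Sum.inl) + F *ᵥ (x ∘ Sum.inr) = 0 ∧ N' *ᵥ (x ∘ Sum.inr) = 0 := by
    intro x
    rw [LinearMap.mem_ker, colMap_apply, Matrix.fromBlocks_mulVec, Matrix.zero_mulVec, zero_add]
    constructor
    · intro h
      exact ⟨funext fun i => congrFun h (Sum.inl i), funext fun i => congrFun h (Sum.inr i)⟩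
    · rintro ⟨h1, h2⟩
      rw [h1, h2]
      ext1 (i | i) <;> rfl
  -- The sequence `0 → ker N → ker φ → ker N'` is exact. By rank-nullity the ranks add up exactly
  -- when `ψ` is onto `ker N'`, that is, when every `x` there can be completed to a kernel vector of
  -- the whole matrix.
  let ψ : LinearMap.ker φ →ₗ[(ℍ[ℝ])ᵐᵒᵖ] (o → ℍ[ℝ]) :=
    (LinearMap.funLeft (ℍ[ℝ])ᵐᵒᵖ ℍ[ℝ] Sum.inr).comp (LinearMap.ker φ).subtype
  let ι : LinearMap.ker (colMap N) →ₗ[(ℍ[ℝ])ᵐᵒᵖ] LinearMap.ker φ :=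
    { toFun := fun v => ⟨Sum.elim v.1 0, (hφ _).2 (by
        have := v.2
        rw [LinearMap.mem_ker, colMap_apply] at this
        simp [this])⟩
      map_add' := fun v w => by ext1; ext1 (i | i) <;> simp
      map_smul' := fun c v => by ext1; ext1 (i | i) <;> simp }
  have hι : Function.Injective ι := by
    intro v w h
    have h1 := congrArg Subtype.val h
    ext1
    funext i
    exact congrFun h1 (Sum.inl i)
  have hker : LinearMap.range ι = LinearMap.ker ψ := by
    ext x
    constructor
    · rintro ⟨v, rfl⟩
      rfl
    · intro hx
      have hx' : x.1 ∘ Sum.inr = 0 := hx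
      have h1 := (hφ x.1).1 x.2
      rw [hx', Matrix.mulVec_zero, add_zero] at h1
      refine ⟨⟨x.1 ∘ Sum.inl, h1.1⟩, Subtype.ext (funext ?_)⟩
      rintro (i | i)
      · rfl
      · exact (congrFun hx' i).symm
  have hψ : LinearMap.range ψ ≤ LinearMap.ker (colMap N') := by
    rintro _ ⟨x, rfl⟩
    exact ((hφ x.1).1 x.2).2
  have e1 := LinearMap.finrank_range_add_finrank_ker φ
  have e2 := LinearMap.finrank_range_add_finrank_ker (colMap N)
  have e3 := LinearMap.finrank_range_add_finrank_ker (colMap N')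
  have e4 := LinearMap.finrank_range_add_finrank_ker ψ
  have e5 : Module.finrank (ℍ[ℝ])ᵐᵒᵖ (n ⊕ o → ℍ[ℝ]) = Module.finrank (ℍ[ℝ])ᵐᵒᵖ (n → ℍ[ℝ]) +
      Module.finrank (ℍ[ℝ])ᵐᵒᵖ (o → ℍ[ℝ]) := by
    rw [← Module.finrank_prod]
    exact (LinearEquiv.sumArrowLequivProdArrow n o (ℍ[ℝ])ᵐᵒᵖ ℍ[ℝ]).finrank_eq
  rw [← hker, LinearMap.finrank_range_of_inj hι] at e4
  have step : quatRank (Matrix.fromBlocks N F 0 N') = quatRank N + quatRank N' ↔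
      LinearMap.range ψ = LinearMap.ker (colMap N') := by
    rw [quatRank_eq_finrank_range, quatRank_eq_finrank_range, quatRank_eq_finrank_range]
    constructor
    · intro h
      refine Submodule.eq_of_le_of_finrank_eq hψ ?_
      change Module.finrank _ (LinearMap.range φ) = _ at h
      omega
    · intro h
      rw [h] at e4
      change Module.finrank _ (LinearMap.range φ) = _
      omega
  rw [step]
  constructor
  · intro h x hx
    have hx' : x ∈ LinearMap.ker (colMap N') := hx
    rw [← h] at hx'
    obtain ⟨y, rfl⟩ := hx'
    refine ⟨-(y.1 ∘ Sum.inl), ?_⟩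
    rw [Matrix.mulVec_neg, eq_neg_iff_add_eq_zero, add_comm]
    exact ((hφ y.1).1 y.2).1
  · intro h
    refine le_antisymm hψ fun x hx => ?_
    obtain ⟨v, hv⟩ := h x hx
    refine ⟨⟨Sum.elim (-v) x, (hφ _).2 ⟨?_, ?_⟩⟩, ?_⟩
    · rw [Sum.elim_comp_inl, Sum.elim_comp_inr, hv, Matrix.mulVec_neg, neg_add_cancel]
    · rw [Sum.elim_comp_inr]
      exact hx
    · rfl

/-- Additional columns leave the rank unchanged if and only if they lie in the column space. -/
theorem quatRank_eq_iff_of_range_le [Fintype m] [Fintype n] [Fintype l] (N : Matrix m n ℍ[ℝ])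
    (M : Matrix m l ℍ[ℝ]) (h : LinearMap.range (colMap N) ≤ LinearMap.range (colMap M)) :
    quatRank M = quatRank N ↔ LinearMap.range (colMap M) ≤ LinearMap.range (colMap N) := by
  rw [quatRank_eq_finrank_range, quatRank_eq_finrank_range]
  exact ⟨fun e => (Submodule.eq_of_le_of_finrank_eq h e.symm).ge,
    fun e => by rw [le_antisymm e h]⟩

theorem quatRank_fromCols_fromCols_eq_iff [Fintype m] [Fintype n] [Fintype l] [Fintype o]
    (A : Matrix m n ℍ[ℝ]) (E : Matrix m o ℍ[ℝ]) (C : Matrix m l ℍ[ℝ]) :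
    quatRank (Matrix.fromCols A (Matrix.fromCols E C)) = quatRank (Matrix.fromCols A C) ↔
      ∀ x, ∃ v w, E *ᵥ x = A *ᵥ v + C *ᵥ w := by
  rw [quatRank_eq_iff_of_range_le]
  · constructor
    · intro h x
      obtain ⟨v, hv⟩ := h ⟨Sum.elim 0 (Sum.elim x 0), rfl⟩
      refine ⟨v ∘ Sum.inl, v ∘ Sum.inr, ?_⟩
      simpa [Matrix.fromCols_mulVec] using hv.symm
    · rintro h _ ⟨x, rfl⟩
      obtain ⟨v, w, hvw⟩ := h (x ∘ Sum.inr ∘ Sum.inl)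
      refine ⟨Sum.elim (x ∘ Sum.inl + v) (x ∘ Sum.inr ∘ Sum.inr + w), ?_⟩
      simp only [colMap_apply, Matrix.fromCols_mulVec, Sum.elim_comp_inl, Sum.elim_comp_inr,
        Matrix.mulVec_add, Function.comp_assoc, hvw]
      abel
  · rintro _ ⟨x, rfl⟩
    refine ⟨Sum.elim (x ∘ Sum.inl) (Sum.elim 0 (x ∘ Sum.inr)), ?_⟩
    simp [Matrix.fromCols_mulVec]

/-- The column space of a quaternion matrix factors it through its rank. -/
theorem exists_rank_factorization [Fintype m] [Fintype n] (M : Matrix m n ℍ[ℝ]) :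
    ∃ (P : Matrix m (Fin (quatRank M)) ℍ[ℝ]) (Q : Matrix (Fin (quatRank M)) n ℍ[ℝ]),
      M = P * Q := by
  let R := LinearMap.range (colMap M)
  have hR : ∀ j, M.col j ∈ R := fun j => by
    rw [show R = _ from range_colMap M]
    exact Submodule.subset_span ⟨j, rfl⟩
  let e := (Module.finBasisOfFinrankEq (ℍ[ℝ])ᵐᵒᵖ R (quatRank_eq_finrank_range M).symm)
  refine ⟨Matrix.of fun i r => (e r).1 i,
    Matrix.of fun r j => (e.repr ⟨M.col j, hR j⟩ r).unop,
    ?_⟩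
  ext1 i j
  have h := congrArg Subtype.val (e.sum_repr ⟨M.col j, hR j⟩)
  have h' : M i j = _ := (congrFun h i).symm
  rw [h', Submodule.coe_sum, Finset.sum_apply]
  rfl

theorem quatRank_mul_le [Fintype l] [Fintype m] [Fintype n] (P : Matrix m l ℍ[ℝ])
    (Q : Matrix l n ℍ[ℝ]) : quatRank (P * Q) ≤ Fintype.card l := by
  rw [quatRank_eq_finrank_range]
  have h : LinearMap.range (colMap (P * Q)) ≤ LinearMap.range (colMap P) := by
    rintro _ ⟨x, rfl⟩
    exact ⟨Q *ᵥ x, by simp⟩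
  refine (Submodule.finrank_mono h).trans ?_
  rw [range_colMap]
  exact finrank_range_le_card P.col

end QuaternionMatrix

/-! ### The involution `etaStar` and the duality that it induces. -/

section EtaStar

variable {η : ℍ[ℝ]}

/-- The anti-automorphism `q ↦ -η q̄ η`. -/
noncomputable def etaConj (η q : ℍ[ℝ]) : ℍ[ℝ] := -η * star q * η

theorem etaConj_zero : etaConj η 0 = 0 := by simp [etaConj]

theorem etaConj_add (q r : ℍ[ℝ]) : etaConj η (q + r) = etaConj η q + etaConj η r := by
  simp [etaConj, mul_add, add_mul]

theorem etaConj_smul (c : ℝ) (q : ℍ[ℝ]) : etaConj η (c • q) = c • etaConj η q := by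
  simp [etaConj]

theorem etaConj_sum {ι : Type*} (t : Finset ι) (f : ι → ℍ[ℝ]) :
    etaConj η (∑ i ∈ t, f i) = ∑ i ∈ t, etaConj η (f i) :=
  map_sum (⟨⟨etaConj η, etaConj_zero⟩, etaConj_add⟩ : ℍ[ℝ] →+ ℍ[ℝ]) f t

/-- The two factors `η` that meet in the middle give `-1`, which cancels one of the two minus signs.
-/
theorem etaConj_mul (hη : η * η = -1) (q r : ℍ[ℝ]) :
    etaConj η (q * r) = etaConj η r * etaConj η q := by
  have : -η * star r * η * (-η * star q * η) = -η * star r * -(η * η) * (star q * η) := by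
    noncomm_ring
  rw [etaConj, etaConj, etaConj, this, hη, star_mul]
  noncomm_ring

theorem etaConj_etaConj (hη : η * η = -1) (hη' : star η = -η) (q : ℍ[ℝ]) :
    etaConj η (etaConj η q) = q := by
  have : etaConj η (etaConj η q) = (η * η) * q * (η * η) := by
    simp only [etaConj, star_mul, star_neg, star_star, hη']
    noncomm_ring
  rw [this, hη]
  simp

variable {m n l : Type*}

theorem etaStar_apply (A : Matrix m n ℍ[ℝ]) (i : n) (j : m) :
    etaStar η A i j = etaConj η (A j i) := rfl

theorem etaStar_zero : etaStar η (0 : Matrix m n ℍ[ℝ]) = 0 := by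
  ext1 i j
  simp [etaStar_apply, etaConj_zero]

theorem etaStar_add (A B : Matrix m n ℍ[ℝ]) :
    etaStar η (A + B) = etaStar η A + etaStar η B := by
  ext1 i j
  simp [etaStar_apply, etaConj_add]

theorem etaStar_smul (c : ℝ) (A : Matrix m n ℍ[ℝ]) : etaStar η (c • A) = c • etaStar η A := by
  ext1 i j
  simp [etaStar_apply, etaConj_smul]

theorem etaStar_mul [Fintype n] (hη : η * η = -1) (A : Matrix m n ℍ[ℝ]) (B : Matrix n l ℍ[ℝ]) :
    etaStar η (A * B) = etaStar η B * etaStar η A := by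
  ext1 i j
  simp [etaStar_apply, Matrix.mul_apply, etaConj_sum, etaConj_mul hη]

theorem etaStar_etaStar (hη : η * η = -1) (hη' : star η = -η) (A : Matrix m n ℍ[ℝ]) :
    etaStar η (etaStar η A) = A := by
  ext1 i j
  simp [etaStar_apply, etaConj_etaConj hη hη']

/-- This exchanges the left kernel of `N` with the right kernel of its η-star. -/
theorem etaConj_comp_vecMul [Fintype m] (hη : η * η = -1) (y : m → ℍ[ℝ]) (N : Matrix m n ℍ[ℝ]) :
    etaConj η ∘ (y ᵥ* N) = etaStar η N *ᵥ (etaConj η ∘ y) := by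
  ext1 i
  simp [Matrix.vecMul, Matrix.mulVec, dotProduct, etaConj_sum, etaConj_mul hη, etaStar_apply]

theorem etaConj_comp_mulVec [Fintype n] (hη : η * η = -1) (N : Matrix m n ℍ[ℝ]) (x : n → ℍ[ℝ]) :
    etaConj η ∘ (N *ᵥ x) = (etaConj η ∘ x) ᵥ* etaStar η N := by
  ext1 i
  simp [Matrix.vecMul, Matrix.mulVec, dotProduct, etaConj_sum, etaConj_mul hη, etaStar_apply]

theorem etaConj_dotProduct [Fintype m] (hη : η * η = -1) (y z : m → ℍ[ℝ]) :
    etaConj η (y ⬝ᵥ z) = (etaConj η ∘ z) ⬝ᵥ (etaConj η ∘ y) := by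
  simp [dotProduct, etaConj_sum, etaConj_mul hη]

/-- An anti-automorphism reverses a rank factorization `P * Q` and keeps its inner dimension.
Applied twice, this plays the role of "row rank equals column rank". -/
theorem quatRank_etaStar_le [Fintype m] [Fintype n] (hη : η * η = -1) (M : Matrix m n ℍ[ℝ]) :
    quatRank (etaStar η M) ≤ quatRank M := by
  obtain ⟨P, Q, h⟩ := exists_rank_factorization M
  have := quatRank_mul_le (etaStar η Q) (etaStar η P)
  rwa [← etaStar_mul hη, ← h, Fintype.card_fin] at this

theorem quatRank_etaStar [Fintype m] [Fintype n] (hη : η * η = -1) (hη' : star η = -η)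
    (M : Matrix m n ℍ[ℝ]) : quatRank (etaStar η M) = quatRank M := by
  refine le_antisymm (quatRank_etaStar_le hη M) ?_
  have := quatRank_etaStar_le hη (etaStar η M)
  rwa [etaStar_etaStar hη hη'] at this

/-- Compatibility of an `η`-Hermitian matrix `F` with a pair of matrices is symmetric. -/
theorem exists_mulVec_eq_swap [Fintype m] [Fintype n] [Fintype l] (hη : η * η = -1)
    (hη' : star η = -η) (F : Matrix m m ℍ[ℝ]) (hF : IsEtaHermitian η F) (N : Matrix m n ℍ[ℝ])
    (N' : Matrix m l ℍ[ℝ]) (h : ∀ x, etaStar η N' *ᵥ x = 0 → ∃ v, F *ᵥ x = N *ᵥ v)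
    (x : m → ℍ[ℝ]) (hx : etaStar η N *ᵥ x = 0) : ∃ v, F *ᵥ x = N' *ᵥ v := by
  refine exists_mulVec_eq_of_forall_vecMul_eq_zero N' _ fun y hy => ?_
  obtain ⟨v, hv⟩ := h (etaConj η ∘ y) (by
    rw [← etaConj_comp_vecMul hη, hy]
    ext1 i
    exact etaConj_zero)
  have hx' : (etaConj η ∘ x) ᵥ* N = 0 := by
    rw [← etaStar_etaStar hη hη' N, ← etaConj_comp_mulVec hη, hx]
    ext1 i
    exact etaConj_zero
  -- Since `F` is η-Hermitian, conjugation turns the pairing of `y` with `F x` into that of the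
  -- conjugate of `x` with `F` applied to the conjugate of `y`. The latter vector is `N v`, and the
  -- conjugate of `x` annihilates `N`.
  have key : etaConj η (y ⬝ᵥ F *ᵥ x) = 0 := by
    rw [etaConj_dotProduct hη, etaConj_comp_mulVec hη, ← hF, ← Matrix.dotProduct_mulVec, hv,
      Matrix.dotProduct_mulVec, hx', zero_dotProduct]
  rw [← etaConj_etaConj hη hη' (y ⬝ᵥ F *ᵥ x), key, etaConj_zero]

end EtaStar

/-! ### Block bidiagonal matrices and the translation of their kernels and ranges into chains. -/

section Bidiag

variable {k : ℕ} {p : Fin k → ℕ} {s : Fin (k + 1) → ℕ}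
  (A : ∀ i : Fin k, Matrix (Fin (p i)) (Fin (s i.castSucc)) ℍ[ℝ])
  (C : ∀ i : Fin k, Matrix (Fin (p i)) (Fin (s i.succ)) ℍ[ℝ])

theorem bidiagBlock_castSucc (i : Fin k) : bidiagBlock A C i i.castSucc = A i := by
  simp [bidiagBlock]

theorem bidiagBlock_succ (i : Fin k) : bidiagBlock A C i i.succ = C i := by
  have h : i.succ ≠ i.castSucc := Fin.castSucc_lt_succ.ne'
  simp [bidiagBlock, h]

theorem bidiagBlock_of_ne {i : Fin k} {j : Fin (k + 1)} (h : j ≠ i.castSucc) (h' : j ≠ i.succ) :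
    bidiagBlock A C i j = 0 := by
  simp [bidiagBlock, h, h']

/-- The block vector with the entries `x i`, `i ∈ I`. -/
def blockVec {ι : Type*} {d : ι → ℕ} (I : Finset ι) (x : ∀ i, Fin (d i) → ℍ[ℝ]) :
    (Σ i : I, Fin (d i)) → ℍ[ℝ] := fun y => x y.1 y.2

theorem exists_blockVec_eq {ι : Type*} {d : ι → ℕ} (I : Finset ι)
    (x : (Σ i : I, Fin (d i)) → ℍ[ℝ]) :
    ∃ y : ∀ i, Fin (d i) → ℍ[ℝ], blockVec I y = x ∧ ∀ i ∉ I, y i = 0 := by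
  classical
  refine ⟨fun i a => if h : i ∈ I then x ⟨⟨i, h⟩, a⟩ else 0, ?_, fun i hi => ?_⟩
  · ext1 ⟨⟨i, h⟩, a⟩
    simp [blockVec, h]
  · ext1 a
    simp [hi]

theorem sum_blockVec {ι : Type*} {d : ι → ℕ} (I : Finset ι) (f : ∀ i, Fin (d i) → ℍ[ℝ]) :
    ∑ y : (Σ i : I, Fin (d i)), f y.1 y.2 = ∑ i ∈ I, ∑ a, f i a := by
  rw [Fintype.sum_sigma]
  exact Finset.sum_coe_sort I fun i => ∑ a, f i a

/-- Deleting a block column amounts to forcing the corresponding `v j` to vanish. -/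
theorem bidiag_mulVec_blockVec (I : Finset (Fin k)) (J : Finset (Fin (k + 1)))
    (v : ∀ j, Fin (s j) → ℍ[ℝ]) (hv : ∀ i ∈ I, (i.castSucc ∉ J → v i.castSucc = 0) ∧
      (i.succ ∉ J → v i.succ = 0)) :
    bidiag A C I J *ᵥ blockVec J v =
      blockVec I fun i => A i *ᵥ v i.castSucc + C i *ᵥ v i.succ := by
  ext1 ⟨⟨i, hi⟩, a⟩
  have h : (bidiag A C I J *ᵥ blockVec J v) ⟨⟨i, hi⟩, a⟩ =
      ∑ j ∈ J, (bidiagBlock A C i j *ᵥ v j) a :=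
    sum_blockVec J fun j b => bidiagBlock A C i j a b * v j b
  rw [h, Finset.sum_eq_add i.castSucc i.succ Fin.castSucc_lt_succ.ne, bidiagBlock_castSucc,
    bidiagBlock_succ]
  · rfl
  · intro j _ hj
    rw [bidiagBlock_of_ne A C hj.1 hj.2, Matrix.zero_mulVec]
    rfl
  · intro hj
    rw [(hv i hi).1 hj, Matrix.mulVec_zero]
    rfl
  · intro hj
    rw [(hv i hi).2 hj, Matrix.mulVec_zero]
    rfl

theorem etaStar_bidiag_mulVec_blockVec (η : ℍ[ℝ]) (I : Finset (Fin k)) (J : Finset (Fin (k + 1)))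
    (x : ∀ i, Fin (p i) → ℍ[ℝ]) :
    etaStar η (bidiag A C I J) *ᵥ blockVec I x =
      blockVec J fun j => ∑ i ∈ I, etaStar η (bidiagBlock A C i j) *ᵥ x i := by
  ext1 ⟨⟨j, hj⟩, b⟩
  have h : (etaStar η (bidiag A C I J) *ᵥ blockVec I x) ⟨⟨j, hj⟩, b⟩ =
      ∑ i ∈ I, (etaStar η (bidiagBlock A C i j) *ᵥ x i) b :=
    sum_blockVec I fun i a => etaStar η (bidiagBlock A C i j) b a * x i a
  rw [h, blockVec, Finset.sum_apply]

theorem signedDiag_mulVec_blockVec (E : ∀ i : Fin k, Matrix (Fin (p i)) (Fin (p i)) ℍ[ℝ])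
    (m n : Fin k) (x : ∀ i, Fin (p i) → ℍ[ℝ]) :
    signedDiag E m n *ᵥ blockVec (Finset.Icc m n) x =
      blockVec (Finset.Icc m n) fun i => (-1 : ℝ) ^ ((i : ℕ) - (m : ℕ)) • (E i *ᵥ x i) := by
  ext1 ⟨i, a⟩
  rw [Matrix.mulVec, dotProduct, Fintype.sum_sigma, Finset.sum_eq_single i]
  · simp only [signedDiag, Matrix.blockDiagonal'_apply_eq, blockVec]
    rw [← Matrix.smul_mulVec]
    rfl
  · intro j _ hj
    refine Finset.sum_eq_zero fun b _ => ?_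
    rw [signedDiag, Matrix.blockDiagonal'_apply_ne _ _ _ hj.symm, zero_mul]
  · simp

theorem isEtaHermitian_signedDiag (η : ℍ[ℝ])
    (E : ∀ i : Fin k, Matrix (Fin (p i)) (Fin (p i)) ℍ[ℝ]) (hE : ∀ i, IsEtaHermitian η (E i))
    (m n : Fin k) : IsEtaHermitian η (signedDiag E m n) := by
  ext1 ⟨i, a⟩ ⟨j, b⟩
  rw [etaStar_apply]
  by_cases h : i = j
  · subst h
    rw [signedDiag, Matrix.blockDiagonal'_apply_eq, Matrix.blockDiagonal'_apply_eq,
      Matrix.smul_apply, Matrix.smul_apply, etaConj_smul, ← etaStar_apply, ← hE]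
  · rw [signedDiag, Matrix.blockDiagonal'_apply_ne _ _ _ h,
      Matrix.blockDiagonal'_apply_ne _ _ _ (Ne.symm h), etaConj_zero]

/-- The condition `ZigzagCondition` for the linear maps of the system with signs. -/
def SignedCondition (η : ℍ[ℝ]) (E : ∀ i : Fin k, Matrix (Fin (p i)) (Fin (p i)) ℍ[ℝ])
    (l r : Fin (k + 1)) (a b : Prop) : Prop :=
  ZigzagCondition (V := fun j => Fin (s j) → ℍ[ℝ]) (V' := fun j => Fin (s j) → ℍ[ℝ])
    (U := fun i => Fin (p i) → ℍ[ℝ]) (U' := fun i => Fin (p i) → ℍ[ℝ])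
    (fun i => colMap (A i)) (fun i => colMap (C i))
    (fun i => colMap (etaStar η (A i))) (fun i => -colMap (etaStar η (C i)))
    (fun i => (-1 : ℝ) ^ (i : ℕ) • colMap (E i)) l r a b

/-- The columns of the block bidiagonal matrix with rows `m, …, n` without the first one if `a`, and
without the last one if `b`. -/
def IsTruncation (m n : Fin k) (J : Finset (Fin (k + 1))) (a b : Prop) : Prop :=
  ∀ j, j ∈ J ↔ m.castSucc ≤ j ∧ j ≤ n.succ ∧ (a → j ≠ m.castSucc) ∧ (b → j ≠ n.succ)

theorem blockVec_eq_iff {ι : Type*} {d : ι → ℕ} {I : Finset ι} {x y : ∀ i, Fin (d i) → ℍ[ℝ]} :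
    blockVec I x = blockVec I y ↔ ∀ i ∈ I, x i = y i :=
  ⟨fun h i hi => funext fun a => congrFun h ⟨⟨i, hi⟩, a⟩, fun h => funext fun w =>
    congrFun (h _ w.1.2) w.2⟩

/-- A block column meets one `A` and one `C`, from different rows. Separating them lets each kernel
equation be read as the equality of two expressions for `z j`. -/
theorem bidiagBlock_eq_add (i : Fin k) (j : Fin (k + 1)) :
    bidiagBlock A C i j = bidiagBlock A 0 i j + bidiagBlock 0 C i j := by
  by_cases h : j = i.castSucc
  · subst h
    simp [bidiagBlock_castSucc]
  · by_cases h' : j = i.succ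
    · subst h'
      simp [bidiagBlock_succ]
    · simp [bidiagBlock_of_ne _ _ h h']

theorem sum_etaStar_bidiagBlock_left (η : ℍ[ℝ]) (I : Finset (Fin k))
    (x : ∀ i, Fin (p i) → ℍ[ℝ]) {i : Fin k} (hi : i ∈ I) :
    ∑ i' ∈ I, etaStar η (bidiagBlock A (0 : ∀ i : Fin k, Matrix (Fin (p i)) (Fin (s i.succ)) ℍ[ℝ])
      i' i.castSucc) *ᵥ x i' = etaStar η (A i) *ᵥ x i := by
  rw [Finset.sum_eq_single_of_mem i hi, bidiagBlock_castSucc]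
  intro i' _ h
  have : bidiagBlock A (0 : ∀ i : Fin k, Matrix (Fin (p i)) (Fin (s i.succ)) ℍ[ℝ])
      i' i.castSucc = 0 := by
    by_cases h' : i.castSucc = i'.succ
    · rw [h', bidiagBlock_succ]
      rfl
    · exact bidiagBlock_of_ne _ _ (fun e => h (Fin.castSucc_injective _ e).symm) h'
  rw [this, etaStar_zero, Matrix.zero_mulVec]

theorem sum_etaStar_bidiagBlock_left_eq_zero (η : ℍ[ℝ]) (I : Finset (Fin k))
    (x : ∀ i, Fin (p i) → ℍ[ℝ]) {j : Fin (k + 1)} (hj : ∀ i ∈ I, j ≠ i.castSucc) :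
    ∑ i' ∈ I, etaStar η (bidiagBlock A (0 : ∀ i : Fin k, Matrix (Fin (p i)) (Fin (s i.succ)) ℍ[ℝ])
      i' j) *ᵥ x i' = 0 := by
  refine Finset.sum_eq_zero fun i' hi' => ?_
  have : bidiagBlock A (0 : ∀ i : Fin k, Matrix (Fin (p i)) (Fin (s i.succ)) ℍ[ℝ]) i' j = 0 := by
    by_cases h' : j = i'.succ
    · subst h'
      rw [bidiagBlock_succ]
      rfl
    · exact bidiagBlock_of_ne _ _ (hj i' hi') h'
  rw [this, etaStar_zero, Matrix.zero_mulVec]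

theorem sum_etaStar_bidiagBlock_right (η : ℍ[ℝ]) (I : Finset (Fin k))
    (x : ∀ i, Fin (p i) → ℍ[ℝ]) {i : Fin k} (hi : i ∈ I) :
    ∑ i' ∈ I, etaStar η (bidiagBlock
      (0 : ∀ i : Fin k, Matrix (Fin (p i)) (Fin (s i.castSucc)) ℍ[ℝ]) C i' i.succ) *ᵥ x i' =
        etaStar η (C i) *ᵥ x i := by
  rw [Finset.sum_eq_single_of_mem i hi, bidiagBlock_succ]
  intro i' _ h
  have : bidiagBlock (0 : ∀ i : Fin k, Matrix (Fin (p i)) (Fin (s i.castSucc)) ℍ[ℝ]) C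
      i' i.succ = 0 := by
    by_cases h' : i.succ = i'.castSucc
    · rw [h', bidiagBlock_castSucc]
      rfl
    · exact bidiagBlock_of_ne _ _ h' (fun e => h (Fin.succ_injective _ e).symm)
  rw [this, etaStar_zero, Matrix.zero_mulVec]

theorem sum_etaStar_bidiagBlock_right_eq_zero (η : ℍ[ℝ]) (I : Finset (Fin k))
    (x : ∀ i, Fin (p i) → ℍ[ℝ]) {j : Fin (k + 1)} (hj : ∀ i ∈ I, j ≠ i.succ) :
    ∑ i' ∈ I, etaStar η (bidiagBlock
      (0 : ∀ i : Fin k, Matrix (Fin (p i)) (Fin (s i.castSucc)) ℍ[ℝ]) C i' j) *ᵥ x i' = 0 := by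
  refine Finset.sum_eq_zero fun i' hi' => ?_
  have : bidiagBlock (0 : ∀ i : Fin k, Matrix (Fin (p i)) (Fin (s i.castSucc)) ℍ[ℝ]) C i' j = 0 := by
    by_cases h' : j = i'.castSucc
    · subst h'
      rw [bidiagBlock_castSucc]
      rfl
    · exact bidiagBlock_of_ne _ _ h' (hj i' hi')
  rw [this, etaStar_zero, Matrix.zero_mulVec]

/-- The kernel of the transposed block bidiagonal matrix, in terms of the common values `z j` of the
two entries in each of its rows. -/
theorem etaStar_bidiag_mulVec_eq_zero_iff (η : ℍ[ℝ]) {m n : Fin k} (hmn : m ≤ n) {a b : Prop}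
    {J' : Finset (Fin (k + 1))} (hJ' : IsTruncation m n J' (¬a) (¬b))
    (x : ∀ i, Fin (p i) → ℍ[ℝ]) :
    etaStar η (bidiag A C (Finset.Icc m n) J') *ᵥ blockVec (Finset.Icc m n) x = 0 ↔
      ∃ z : ∀ j, Fin (s j) → ℍ[ℝ], (∀ i ∈ Finset.Icc m n,
        etaStar η (A i) *ᵥ x i = z i.castSucc ∧ -(etaStar η (C i) *ᵥ x i) = z i.succ) ∧
        (a → z m.castSucc = 0) ∧ (b → z n.succ = 0) := by
  set I := Finset.Icc m n
  have hI : ∀ i, i ∈ I ↔ m ≤ i ∧ i ≤ n := fun i => Finset.mem_Icc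
  have hmI : m ∈ I := (hI m).2 ⟨le_rfl, hmn⟩
  have hnI : n ∈ I := (hI n).2 ⟨hmn, le_rfl⟩
  have hcn : ∀ i ∈ I, n.succ ≠ i.castSucc := fun i hi =>
    (Fin.castSucc_lt_succ_iff.2 ((hI i).1 hi).2).ne'
  have hsm : ∀ i ∈ I, m.castSucc ≠ i.succ := fun i hi =>
    (Fin.castSucc_lt_succ_iff.2 ((hI i).1 hi).1).ne
  let SA : ∀ j, Fin (s j) → ℍ[ℝ] := fun j => ∑ i ∈ I, etaStar η (bidiagBlock A
    (0 : ∀ i : Fin k, Matrix (Fin (p i)) (Fin (s i.succ)) ℍ[ℝ]) i j) *ᵥ x i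
  let SC : ∀ j, Fin (s j) → ℍ[ℝ] := fun j => ∑ i ∈ I, etaStar η (bidiagBlock
    (0 : ∀ i : Fin k, Matrix (Fin (p i)) (Fin (s i.castSucc)) ℍ[ℝ]) C i j) *ᵥ x i
  have hSA : ∀ i ∈ I, SA i.castSucc = etaStar η (A i) *ᵥ x i := fun i hi =>
    sum_etaStar_bidiagBlock_left A η I x hi
  have hSC : ∀ i ∈ I, SC i.succ = etaStar η (C i) *ᵥ x i := fun i hi =>
    sum_etaStar_bidiagBlock_right C η I x hi
  have hSAn : SA n.succ = 0 := sum_etaStar_bidiagBlock_left_eq_zero A η I x hcn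
  have hSCm : SC m.castSucc = 0 := sum_etaStar_bidiagBlock_right_eq_zero C η I x hsm
  have hker : etaStar η (bidiag A C I J') *ᵥ blockVec I x = 0 ↔ ∀ j ∈ J', SA j + SC j = 0 := by
    rw [etaStar_bidiag_mulVec_blockVec, show (0 : (Σ j : J', Fin (s j)) → ℍ[ℝ]) =
      blockVec J' 0 from rfl, blockVec_eq_iff]
    refine forall₂_congr fun j _ => ?_
    simp only [SA, SC, ← Finset.sum_add_distrib, ← Matrix.add_mulVec, ← etaStar_add,
      ← bidiagBlock_eq_add]
    rfl
  have hmJ : a → m.castSucc ∈ J' := fun ha => (hJ' _).2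
    ⟨le_rfl, (Fin.castSucc_lt_succ_iff.2 hmn).le, fun h => absurd ha h, fun _ => (hcn m hmI).symm⟩
  have hnJ : b → n.succ ∈ J' := fun hb => (hJ' _).2
    ⟨(Fin.castSucc_lt_succ_iff.2 hmn).le, le_rfl, fun _ => hcn m hmI, fun h => absurd hb h⟩
  rw [hker]
  constructor
  · intro h
    -- The kernel equations say `SA j = -SC j`, and this is `z j`. The last node has no `A`
    -- contribution, so there the value must come from `C`.
    refine ⟨Function.update SA n.succ (-SC n.succ), fun i hi => ⟨?_, ?_⟩, fun ha => ?_,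
      fun hb => ?_⟩
    · rw [Function.update_of_ne (hcn i hi).symm, hSA i hi]
    · by_cases hin : i = n
      · subst hin
        rw [Function.update_self, hSC i hi]
      · have hlt : i < n := lt_of_le_of_ne ((hI i).1 hi).2 hin
        have hne : i.succ ≠ n.succ := fun e => hin (Fin.succ_injective _ e)
        rw [Function.update_of_ne hne, ← hSC i hi, neg_eq_iff_add_eq_zero, add_comm]
        exact h _ ((hJ' _).2 ⟨(Fin.castSucc_lt_succ_iff.2 ((hI i).1 hi).1).le,
          Fin.succ_le_succ_iff.2 hlt.le, fun _ => (hsm i hi).symm, fun _ => hne⟩)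
    · rw [Function.update_of_ne (hcn m hmI).symm]
      simpa [hSCm] using h _ (hmJ ha)
    · rw [Function.update_self, neg_eq_zero]
      simpa [hSAn] using h _ (hnJ hb)
  · rintro ⟨z, hz, hza, hzb⟩ j hj
    obtain ⟨h1, h2, h3, h4⟩ := (hJ' j).1 hj
    have hA : SA j = z j := by
      by_cases hjn : j = n.succ
      · subst hjn
        rw [hSAn, hzb (by_contra fun hb => h4 hb rfl)]
      · obtain ⟨i, rfl⟩ := Fin.exists_castSucc_eq.2
          (ne_of_lt ((lt_of_le_of_ne h2 hjn).trans_le (Fin.le_last _)))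
        have hi : i ∈ I := (hI i).2 ⟨Fin.castSucc_le_castSucc_iff.1 h1,
          Fin.castSucc_lt_succ_iff.1 (lt_of_le_of_ne h2 hjn)⟩
        rw [hSA i hi, (hz i hi).1]
    have hC : SC j = -z j := by
      by_cases hjm : j = m.castSucc
      · subst hjm
        rw [hSCm, hza (by_contra fun ha => h3 ha rfl), neg_zero]
      · have hlt : m.castSucc < j := lt_of_le_of_ne h1 (Ne.symm hjm)
        obtain ⟨i, rfl⟩ := Fin.exists_succ_eq.2 (ne_of_gt ((Fin.zero_le _).trans_lt hlt))
        have hi : i ∈ I := (hI i).2 ⟨Fin.castSucc_lt_succ_iff.1 hlt, Fin.succ_le_succ_iff.1 h2⟩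
        rw [hSC i hi, ← (hz i hi).2, neg_neg]
    rw [hA, hC, add_neg_cancel]

/-- A prescribed zero end deletes a column from `J` (there `v = 0`) but keeps the row in `J'` (an
equation forcing `z = 0`), hence the negations. The signs counted from `0` and from `m` differ by
the global factor `(-1) ^ m`, which `v` absorbs. -/
theorem signedCondition_iff (η : ℍ[ℝ]) (E : ∀ i : Fin k, Matrix (Fin (p i)) (Fin (p i)) ℍ[ℝ])
    {m n : Fin k} (hmn : m ≤ n) {a b : Prop} {J J' : Finset (Fin (k + 1))}
    (hJ : IsTruncation m n J a b) (hJ' : IsTruncation m n J' (¬a) (¬b)) :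
    SignedCondition A C η E m.castSucc n.succ a b ↔
      ∀ x, etaStar η (bidiag A C (Finset.Icc m n) J') *ᵥ x = 0 →
        ∃ v, signedDiag E m n *ᵥ x = bidiag A C (Finset.Icc m n) J *ᵥ v := by
  have hI : ∀ i, i ∈ Finset.Icc m n ↔ m.castSucc ≤ i.castSucc ∧ i.succ ≤ n.succ := fun i => by
    rw [Finset.mem_Icc, Fin.castSucc_le_castSucc_iff, Fin.succ_le_succ_iff]
  have hlr : m.castSucc ≠ n.succ := (Fin.castSucc_lt_succ_iff.2 hmn).ne
  have hsign : ∀ i ∈ Finset.Icc m n, ((-1 : ℝ) ^ (m : ℕ)) * (-1) ^ (i : ℕ) =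
      (-1) ^ ((i : ℕ) - (m : ℕ)) := by
    intro i hi
    obtain ⟨d, hd⟩ := Nat.exists_eq_add_of_le (show (m : ℕ) ≤ i from (Finset.mem_Icc.1 hi).1)
    rw [hd, Nat.add_sub_cancel_left, pow_add, ← mul_assoc, ← mul_pow]
    simp
  have hsq : ((-1 : ℝ) ^ (m : ℕ)) * (-1) ^ (m : ℕ) = 1 := by
    rw [← mul_pow]
    simp
  constructor
  · intro h x hx
    obtain ⟨x, rfl, -⟩ := exists_blockVec_eq _ x
    obtain ⟨z, hz, hza, hzb⟩ := (etaStar_bidiag_mulVec_eq_zero_iff A C η hmn hJ' x).1 hx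
    obtain ⟨v, hva, hvb, hv⟩ := h x z (fun i h1 h2 => hz i ((hI i).2 ⟨h1, h2⟩)) hza hzb
    refine ⟨blockVec J ((-1 : ℝ) ^ (m : ℕ) • v), ?_⟩
    rw [signedDiag_mulVec_blockVec, bidiag_mulVec_blockVec, blockVec_eq_iff]
    · intro i hi
      have := hv i ((hI i).1 hi).1 ((hI i).1 hi).2
      simp only [LinearMap.smul_apply, colMap_apply] at this
      rw [Pi.smul_apply, Pi.smul_apply, Matrix.mulVec_smul, Matrix.mulVec_smul, ← smul_add, ← this,
        smul_smul, hsign i hi]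
    · intro i hi
      obtain ⟨h1, h2⟩ := (hI i).1 hi
      have h3 : i.castSucc ≠ n.succ := (Fin.castSucc_lt_succ.trans_le h2).ne
      have h4 : i.succ ≠ m.castSucc := (h1.trans_lt Fin.castSucc_lt_succ).ne'
      constructor
      · intro hiJ
        have : a ∧ i.castSucc = m.castSucc := by
          by_contra hc
          exact hiJ ((hJ _).2 ⟨h1, Fin.castSucc_lt_succ.le.trans h2, fun ha e => hc ⟨ha, e⟩,
            fun _ => h3⟩)
        rw [Pi.smul_apply, this.2, hva this.1, smul_zero]
      · intro hiJ
        have : b ∧ i.succ = n.succ := by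
          by_contra hc
          exact hiJ ((hJ _).2 ⟨h1.trans Fin.castSucc_lt_succ.le, h2, fun _ => h4,
            fun hb e => hc ⟨hb, e⟩⟩)
        rw [Pi.smul_apply, this.2, hvb this.1, smul_zero]
  · intro h x z hz hza hzb
    obtain ⟨v, hv⟩ := h (blockVec _ x) ((etaStar_bidiag_mulVec_eq_zero_iff A C η hmn hJ' x).2
      ⟨z, fun i hi => hz i ((hI i).1 hi).1 ((hI i).1 hi).2, hza, hzb⟩)
    obtain ⟨v, rfl, hvJ⟩ := exists_blockVec_eq _ v
    rw [signedDiag_mulVec_blockVec, bidiag_mulVec_blockVec _ _ _ _ _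
      (fun i _ => ⟨fun h => hvJ _ h, fun h => hvJ _ h⟩), blockVec_eq_iff] at hv
    refine ⟨(-1 : ℝ) ^ (m : ℕ) • v, fun ha => ?_, fun hb => ?_, fun i h1 h2 => ?_⟩
    · rw [Pi.smul_apply, hvJ _ fun hm => ((hJ _).1 hm).2.2.1 ha rfl, smul_zero]
    · rw [Pi.smul_apply, hvJ _ fun hm => ((hJ _).1 hm).2.2.2 hb rfl, smul_zero]
    · have hi := (hI i).2 ⟨h1, h2⟩
      have := hv i hi
      simp only [LinearMap.smul_apply, colMap_apply]
      rw [Pi.smul_apply, Pi.smul_apply, Matrix.mulVec_smul, Matrix.mulVec_smul, ← smul_add, ← this,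
        smul_smul, ← hsign i hi, ← mul_assoc, hsq, one_mul]

end Bidiag

/-! ### Solvability conditions expressed through ranks, and the reduction of the η-Hermitian system.
-/

section SignedCondition

variable {k : ℕ} {p : Fin k → ℕ} {s : Fin (k + 1) → ℕ}
  {A : ∀ i : Fin k, Matrix (Fin (p i)) (Fin (s i.castSucc)) ℍ[ℝ]}
  {C : ∀ i : Fin k, Matrix (Fin (p i)) (Fin (s i.succ)) ℍ[ℝ]}
  {η : ℍ[ℝ]} {E : ∀ i : Fin k, Matrix (Fin (p i)) (Fin (p i)) ℍ[ℝ]}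

/-- Negating both end types exchanges the two truncations `J` and `J'`, and compatibility with an
η-Hermitian diagonal is symmetric in the two truncated matrices. -/
theorem SignedCondition.swap (hη : η * η = -1) (hη' : star η = -η)
    (hE : ∀ i, IsEtaHermitian η (E i)) {m n : Fin k} (hmn : m ≤ n) {a b : Prop}
    (h : SignedCondition A C η E m.castSucc n.succ a b) :
    SignedCondition A C η E m.castSucc n.succ (¬a) (¬b) := by
  classical
  have hex : ∀ a b : Prop, ∃ J, IsTruncation m n J a b := fun a b =>
    ⟨Finset.univ.filter fun j => m.castSucc ≤ j ∧ j ≤ n.succ ∧ (a → j ≠ m.castSucc) ∧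
      (b → j ≠ n.succ), fun j => by simp⟩
  obtain ⟨J, hJ⟩ := hex a b
  obtain ⟨J', hJ'⟩ := hex (¬a) (¬b)
  rw [signedCondition_iff A C η E hmn hJ hJ'] at h
  rw [signedCondition_iff A C η E hmn hJ' (by simpa only [not_not] using hJ)]
  exact exists_mulVec_eq_swap hη hη' _ (isEtaHermitian_signedDiag η E hE m n) _ _ h

/-- On a single equation the chain is one vector `x`, with `z` determined by it; the sign is moved
into `v` and `w`. -/
theorem signedCondition_self_iff (m : Fin k) (b : Prop) :
    SignedCondition A C η E m.castSucc m.succ False b ↔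
      ∀ x, (b → etaStar η (C m) *ᵥ x = 0) →
        ∃ v w, (b → w = 0) ∧ E m *ᵥ x = A m *ᵥ v + C m *ᵥ w := by
  have hne : m.castSucc ≠ m.succ := Fin.castSucc_lt_succ.ne
  have honly : ∀ i : Fin k, m.castSucc ≤ i.castSucc → i.succ ≤ m.succ → i = m := fun i h1 h2 =>
    le_antisymm (Fin.succ_le_succ_iff.1 h2) (Fin.castSucc_le_castSucc_iff.1 h1)
  have hsq : ((-1 : ℝ) ^ (m : ℕ)) * (-1) ^ (m : ℕ) = 1 := by
    rw [← mul_pow]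
    simp
  constructor
  · intro h x hx
    obtain ⟨v, -, hvb, hv⟩ := h (Function.update 0 m x)
      (Function.update (Function.update 0 m.castSucc (etaStar η (A m) *ᵥ x)) m.succ
        (-(etaStar η (C m) *ᵥ x))) (by
          intro i h1 h2
          obtain rfl := honly i h1 h2
          rw [Function.update_of_ne hne]
          simp) False.elim (fun hb => by simp [hx hb])
    have := hv m le_rfl le_rfl
    simp only [LinearMap.smul_apply, colMap_apply, Function.update_self] at this
    refine ⟨(-1 : ℝ) ^ (m : ℕ) • v m.castSucc, (-1 : ℝ) ^ (m : ℕ) • v m.succ,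
      fun hb => by rw [hvb hb, smul_zero], ?_⟩
    rw [Matrix.mulVec_smul, Matrix.mulVec_smul, ← smul_add, ← this, smul_smul, hsq, one_smul]
  · intro h x z hz _ hzb
    obtain ⟨v, w, hw, hvw⟩ := h (x m) (fun hb => by
      have := (hz m le_rfl le_rfl).2
      rw [hzb hb] at this
      exact neg_eq_zero.1 this)
    refine ⟨Function.update (Function.update 0 m.castSucc ((-1 : ℝ) ^ (m : ℕ) • v)) m.succ
      ((-1 : ℝ) ^ (m : ℕ) • w), False.elim, fun hb => by simp [hw hb], fun i h1 h2 => ?_⟩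
    obtain rfl := honly i h1 h2
    rw [Function.update_of_ne hne]
    simp only [LinearMap.smul_apply, colMap_apply, Function.update_self]
    rw [Matrix.mulVec_smul, Matrix.mulVec_smul, ← smul_add, ← hvw]

theorem rank_fromCols_iff_signedCondition (i : Fin k) :
    quatRank (Matrix.fromCols (A i) (Matrix.fromCols (E i) (C i))) =
      quatRank (Matrix.fromCols (A i) (C i)) ↔
        SignedCondition A C η E i.castSucc i.succ False False := by
  rw [quatRank_fromCols_fromCols_eq_iff, signedCondition_self_iff]
  simp

theorem rank_fromBlocks_iff_signedCondition (hη : η * η = -1) (hη' : star η = -η) (i : Fin k) :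
    quatRank (Matrix.fromBlocks (A i) (E i) 0 (etaStar η (C i))) =
      quatRank (A i) + quatRank (C i) ↔
        SignedCondition A C η E i.castSucc i.succ False True := by
  rw [← quatRank_etaStar hη hη' (C i), quatRank_fromBlocks_eq_iff, signedCondition_self_iff]
  simp

theorem rank_staircase_iff_signedCondition (hη : η * η = -1) (hη' : star η = -η) {m n : Fin k}
    (hmn : m ≤ n) {a b : Prop} {J J' : Finset (Fin (k + 1))} (hJ : IsTruncation m n J a b)
    (hJ' : IsTruncation m n J' (¬a) (¬b)) :
    quatRank (staircase η A C E m n J J') =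
      quatRank (bidiag A C (Finset.Icc m n) J) + quatRank (bidiag A C (Finset.Icc m n) J') ↔
        SignedCondition A C η E m.castSucc n.succ a b := by
  rw [← quatRank_etaStar hη hη' (bidiag A C (Finset.Icc m n) J'), staircase,
    quatRank_fromBlocks_eq_iff, signedCondition_iff A C η E hmn hJ hJ']

/-- The system has a solution if and only if all its solvability conditions hold. -/
theorem exists_solution_iff_signedCondition :
    (∃ X : ∀ j : Fin (k + 1), Matrix (Fin (s j)) (Fin (s j)) ℍ[ℝ], ∀ i : Fin k,
      A i * X i.castSucc * etaStar η (A i) + C i * X i.succ * etaStar η (C i) = E i) ↔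
      ∀ l r : Fin (k + 1), l < r → ∀ a b : Prop, SignedCondition A C η E l r a b := by
  have hsq : ∀ n : ℕ, ((-1 : ℝ) ^ n) * (-1) ^ n = 1 := fun n => by
    rw [← mul_pow]
    simp
  constructor
  · rintro ⟨X, hX⟩ l r _ a b
    -- The sign of `X (i + 1)` relative to `X i` cancels the minus sign in `D i`, leaving the common
    -- factor `(-1) ^ i` that multiplies `E i`.
    refine zigzagCondition_of_solution _ (fun j => colMap ((-1 : ℝ) ^ (j : ℕ) • X j))
      (fun i u => ?_) l r a b
    simp only [colMap_apply, LinearMap.neg_apply, LinearMap.smul_apply, Fin.val_castSucc,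
      Fin.val_succ, ← hX i, Matrix.add_mulVec, Matrix.smul_mulVec, Matrix.mulVec_neg,
      Matrix.mulVec_mulVec, Matrix.mulVec_smul, smul_add, pow_succ, Matrix.mul_assoc,
      Matrix.smul_mul]
    simp
  · intro h
    obtain ⟨X, hX⟩ := exists_zigzag_solution _ h
    choose Y hY using fun j => exists_eq_colMap (X j)
    refine ⟨fun j => (-1 : ℝ) ^ (j : ℕ) • Y j, fun i => Matrix.ext_iff_mulVec.2 fun u => ?_⟩
    have h1 := congrArg (fun w => (-1 : ℝ) ^ (i : ℕ) • w) (hX i u)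
    simp only [hY, LinearMap.smul_apply, colMap_apply, smul_smul, hsq, one_smul] at h1
    rw [← h1]
    simp only [LinearMap.neg_apply, colMap_apply, Fin.val_castSucc, Fin.val_succ, pow_succ,
      Matrix.add_mulVec, Matrix.smul_mulVec, Matrix.mulVec_neg, Matrix.mulVec_mulVec, smul_add,
      Matrix.mul_assoc, Matrix.mul_smul, Matrix.smul_mul]
    simp

/-- Every solvable system with `η`-Hermitian right-hand sides has an `η`-Hermitian solution. -/
theorem exists_isEtaHermitian_solution_iff (hη : η * η = -1) (hη' : star η = -η)
    (hE : ∀ i, IsEtaHermitian η (E i)) :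
    (∃ X : ∀ j : Fin (k + 1), Matrix (Fin (s j)) (Fin (s j)) ℍ[ℝ],
      (∀ j, IsEtaHermitian η (X j)) ∧ ∀ i : Fin k,
      A i * X i.castSucc * etaStar η (A i) + C i * X i.succ * etaStar η (C i) = E i) ↔
    ∃ X : ∀ j : Fin (k + 1), Matrix (Fin (s j)) (Fin (s j)) ℍ[ℝ], ∀ i : Fin k,
      A i * X i.castSucc * etaStar η (A i) + C i * X i.succ * etaStar η (C i) = E i := by
  constructor
  · rintro ⟨X, -, hX⟩
    exact ⟨X, hX⟩
  · rintro ⟨X, hX⟩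
    -- Taking the η-star of each equation shows that `etaStar η (X j)` is again a solution, and so
    -- is the average.
    refine ⟨fun j => (2⁻¹ : ℝ) • (X j + etaStar η (X j)), fun j => ?_, fun i => ?_⟩
    · rw [IsEtaHermitian, etaStar_smul, etaStar_add, etaStar_etaStar hη hη',
        add_comm (etaStar η (X j))]
    · have h1 := congrArg (etaStar η) (hX i)
      rw [← hE i, etaStar_add, etaStar_mul hη, etaStar_mul hη, etaStar_mul hη, etaStar_mul hη,
        etaStar_etaStar hη hη', etaStar_etaStar hη hη', ← Matrix.mul_assoc,
        ← Matrix.mul_assoc] at h1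
      have h2 : E i = (2⁻¹ : ℝ) • (E i + E i) := by
        rw [← two_smul ℝ (E i), smul_smul]
        norm_num
      rw [h2]
      nth_rewrite 1 [← hX i]
      rw [← h1]
      simp only [Matrix.mul_smul, Matrix.smul_mul, Matrix.mul_add, Matrix.add_mul, smul_add]
      abel

end SignedCondition

/-! ### The quaternion units and the final assembly. -/

theorem quatUnit_mul_self_and_star {η : ℍ[ℝ]} (hη : η = quatI ∨ η = quatJ ∨ η = quatK) :
    η * η = -1 ∧ star η = -η := by
  rcases hη with rfl | rfl | rfl <;> constructor <;> ext <;>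
    simp only [Quaternion.re_mul, Quaternion.imI_mul, Quaternion.imJ_mul, Quaternion.imK_mul,
      Quaternion.re_star, Quaternion.imI_star, Quaternion.imJ_star, Quaternion.imK_star,
      Quaternion.re_neg, Quaternion.imI_neg, Quaternion.imJ_neg, Quaternion.imK_neg,
      Quaternion.re_one, Quaternion.imI_one, Quaternion.imJ_one, Quaternion.imK_one] <;>
    simp [quatI, quatJ, quatK]

theorem theorem4p2 (η : ℍ[ℝ]) (hη : η = quatI ∨ η = quatJ ∨ η = quatK)
    (k : ℕ) (p : Fin k → ℕ) (s : Fin (k + 1) → ℕ)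
    (A : ∀ i : Fin k, Matrix (Fin (p i)) (Fin (s i.castSucc)) ℍ[ℝ])
    (C : ∀ i : Fin k, Matrix (Fin (p i)) (Fin (s i.succ)) ℍ[ℝ])
    (E : ∀ i : Fin k, Matrix (Fin (p i)) (Fin (p i)) ℍ[ℝ])
    (hE : ∀ i, IsEtaHermitian η (E i)) :
    (∃ X : ∀ j : Fin (k + 1), Matrix (Fin (s j)) (Fin (s j)) ℍ[ℝ],
      (∀ j, IsEtaHermitian η (X j)) ∧
      ∀ i : Fin k,
        A i * X i.castSucc * etaStar η (A i) + C i * X i.succ * etaStar η (C i) = E i) ↔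
    ((∀ i : Fin k,
        quatRank (Matrix.fromCols (A i) (Matrix.fromCols (E i) (C i))) =
            quatRank (Matrix.fromCols (A i) (C i)) ∧
        quatRank (Matrix.fromBlocks (A i) (E i) 0 (etaStar η (C i))) =
            quatRank (A i) + quatRank (C i)) ∧
      ∀ m n : Fin k, m < n →
        quatRank (staircase η A C E m n
            (Finset.Icc m.castSucc n.succ) (Finset.Icc m.succ n.castSucc)) =
          quatRank (bidiag A C (Finset.Icc m n) (Finset.Icc m.castSucc n.succ)) +
            quatRank (bidiag A C (Finset.Icc m n) (Finset.Icc m.succ n.castSucc)) ∧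
        quatRank (staircase η A C E m n
            (Finset.Icc m.castSucc n.castSucc) (Finset.Icc m.succ n.succ)) =
          quatRank (bidiag A C (Finset.Icc m n) (Finset.Icc m.castSucc n.castSucc)) +
            quatRank (bidiag A C (Finset.Icc m n) (Finset.Icc m.succ n.succ))) := by

  obtain ⟨hsq, hstar⟩ := quatUnit_mul_self_and_star hη
  rw [exists_isEtaHermitian_solution_iff hsq hstar hE, exists_solution_iff_signedCondition]
  -- The first staircase equality has end types `(False, False)` and the second `(False, True)`; in
  -- each, the other index set carries the negated types.
  have hT₁ : ∀ m n : Fin k, m < n →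
      IsTruncation m n (Finset.Icc m.castSucc n.succ) False False := fun m n _ j => by
    simp
  have hT₂ : ∀ m n : Fin k, m < n →
      IsTruncation m n (Finset.Icc m.succ n.castSucc) (¬False) (¬False) := fun m n h j => by
    simp only [Finset.mem_Icc, Fin.le_def, Fin.lt_def, Ne, Fin.ext_iff, Fin.val_castSucc,
      Fin.val_succ, not_false_eq_true, forall_const] at h ⊢
    omega
  have hT₃ : ∀ m n : Fin k, m < n →
      IsTruncation m n (Finset.Icc m.castSucc n.castSucc) False True := fun m n h j => by
    simp only [Finset.mem_Icc, Fin.le_def, Fin.lt_def, Ne, Fin.ext_iff, Fin.val_castSucc,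
      Fin.val_succ, false_imp_iff, true_and, forall_const] at h ⊢
    omega
  have hT₄ : ∀ m n : Fin k, m < n →
      IsTruncation m n (Finset.Icc m.succ n.succ) (¬False) (¬True) := fun m n h j => by
    simp only [Finset.mem_Icc, Fin.le_def, Fin.lt_def, Ne, Fin.ext_iff, Fin.val_castSucc,
      Fin.val_succ, not_true_eq_false, not_false_eq_true, false_imp_iff, and_true, forall_const] at h ⊢
    omega
  constructor
  · intro h
    have h' : ∀ m n : Fin k, m ≤ n → ∀ a b : Prop,
        SignedCondition A C η E m.castSucc n.succ a b := fun m n hmn =>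
      h _ _ (Fin.castSucc_lt_succ_iff.2 hmn)
    exact ⟨fun i => ⟨(rank_fromCols_iff_signedCondition i).2 (h' i i le_rfl _ _),
        (rank_fromBlocks_iff_signedCondition hsq hstar i).2 (h' i i le_rfl _ _)⟩,
      fun m n hmn => ⟨(rank_staircase_iff_signedCondition hsq hstar hmn.le (hT₁ m n hmn)
          (hT₂ m n hmn)).2 (h' m n hmn.le _ _),
        (rank_staircase_iff_signedCondition hsq hstar hmn.le (hT₃ m n hmn)
          (hT₄ m n hmn)).2 (h' m n hmn.le _ _)⟩⟩
  · rintro ⟨h₁, h₂⟩ l r hlr a b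
    obtain ⟨m, rfl⟩ := Fin.exists_castSucc_eq.2 (hlr.trans_le (Fin.le_last r)).ne
    obtain ⟨n, rfl⟩ := Fin.exists_succ_eq.2 ((Fin.zero_le _).trans_lt hlr).ne'
    have hmn : m ≤ n := Fin.castSucc_lt_succ_iff.1 hlr
    have key : ∀ b : Prop, SignedCondition A C η E m.castSucc n.succ False b := by
      intro b
      rcases hmn.eq_or_lt with rfl | hlt
      · by_cases hb : b
        · rw [eq_true hb]
          exact (rank_fromBlocks_iff_signedCondition hsq hstar m).1 (h₁ m).2
        · rw [eq_false hb]
          exact (rank_fromCols_iff_signedCondition m).1 (h₁ m).1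
      · by_cases hb : b
        · rw [eq_true hb]
          exact (rank_staircase_iff_signedCondition hsq hstar hmn (hT₃ m n hlt)
            (hT₄ m n hlt)).1 (h₂ m n hlt).2
        · rw [eq_false hb]
          exact (rank_staircase_iff_signedCondition hsq hstar hmn (hT₁ m n hlt)
            (hT₂ m n hlt)).1 (h₂ m n hlt).1
    by_cases ha : a
    -- A zero left end with right type `b` is dual to a free left end with right type `¬b`.
    · have := (key (¬b)).swap hsq hstar hE hmn
      rwa [not_not, not_false_eq_true, ← eq_true ha] at this
    · rw [eq_false ha]
      exact key b
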